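/- Let $d\ge 2$ and let $\mathbb T_d$ be the infinite rooted $d$-ary tree (each vertex has $d$ children), with one extra vertex $\mathfrak b$ attached to the root. Chase-escape with death with rates $\lambda>0$ and $\rho\ge 0$ is the continuous-time Markov process in which each site is white, red, blue or dead; initially the root is red, $\mathfrak b$ is blue and all other vertices are white; a red vertex turns each adjacent white vertex red at rate $\lambda$, a blue vertex turns each adjacent red vertex blue at rate $1$, each red vertex dies at rate $\rho$, independently, and blue and dead sites never change again. For $\rho=0$ this is ordinary chase-escape. Let $\mathcal B$ be the (random) set of sites that are ever blue, including $\mathfrak b$, let $$\rho_c=\rho_c(d,\lambda)=\inf\{\rho\ge 0 : P_{\lambda,\rho}(|\mathcal B|=\infty)=0\},$$ and put $\lambda_c^{\pm}=2d-1\pm 2\sqrt{d^2-d}$ and $\Lambda=(\lambda_c^-,\lambda_c^+)$. Theorem 2. For every $\lambda\in\Lambda$: (i) if $\rho>\rho_c$, then $E_{\lambda,\rho}|\mathcal B|<\infty$; (ii) if $\rho=\rho_c$, then $E_{\lambda,\rho}|\mathcal B|=\infty$. By contrast, in ordinary chase-escape with its critical rate, that is for $\rho=0$ and $\lambda=\lambda_c^-$,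 one has $E|\mathcal B|<\infty$. -/

import Mathlib

open MeasureTheory ProbabilityTheory
open scoped ENNReal NNReal

noncomputable section

namespace ChaseEscape

/-- The states of a site: white (empty), red (prey), blue (predator), dead. -/
inductive State
  | white
  | red
  | blue
  | dead

/-- Vertices of the infinite rooted `d`-ary tree, as finite words over `Fin d`.  The root is the
empty word, and the `d` children of `p` are the words `i :: p` with `i : Fin d`. -/
abbrev TreeVertex (d : ℕ) := List (Fin d)

/-- The sites of the process: the vertices `some v` of the tree, and the one extra vertex `none`
which is attached to the root and is blue from the start. -/
abbrev Site (d : ℕ) := Option (TreeVertex d)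

/-- The clocks carried by a tree vertex `v`.
* `spread`: red spreads to `v` from its parent (unused at the root, which starts red);
* `chase`: blue spreads to `v` from its parent (from the extra blue vertex if `v` is the root);
* `death`: `v` dies. -/
inductive ClockKind
  | spread
  | chase
  | death

/-- A realization of all clocks, each normalized to have rate `1`.  Each transition of the Markovian
dynamics can be used at most once per edge or vertex of the tree, so one exponential waiting time
per transition, started when the transition becomes possible, is the first point of the
corresponding Poisson process after that time. -/
abbrev Clocks (d : ℕ) := TreeVertex d × ClockKind → ℝ

instance stdExp_isProbabilityMeasure : IsProbabilityMeasure (expMeasure 1) :=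
  isProbabilityMeasure_expMeasure one_pos

/-- The law of the clocks: independent exponential variables of rate `1`. -/
def clockLaw (d : ℕ) : Measure (Clocks d) :=
  Measure.infinitePi fun _ => expMeasure 1

/-- The waiting time of rate `r` obtained from a rate-one exponential variable `e`, namely `e / r`;
it is infinite (for `e > 0`) when `r = 0`. -/
def waiting (e r : ℝ) : ℝ≥0∞ := ENNReal.ofReal e / ENNReal.ofReal r

section Dynamics

variable {d : ℕ} (lam rho : ℝ) (ω : Clocks d)

/-- Waiting time, once the parent of `v` is red, for red to spread along the edge to `v`. -/
def spreadWait (v : TreeVertex d) : ℝ≥0∞ := waiting (ω (v, ClockKind.spread)) lam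

/-- Waiting time, once the parent of `v` is blue and `v` is red, for blue to spread to `v`. -/
def chaseWait (v : TreeVertex d) : ℝ≥0∞ := waiting (ω (v, ClockKind.chase)) 1

/-- Waiting time, once `v` is red, for `v` to die. -/
def lifeWait (v : TreeVertex d) : ℝ≥0∞ := waiting (ω (v, ClockKind.death)) rho

/-- The time at which `v` turns blue, if `v` turns red at time `r` and its parent turns blue at
time `b` (`⊤` stands for never).  On a tree, a vertex can only become red while its parent is red,
so `v` is already red (or dead) at time `b`.  It turns blue at `b + chaseWait` unless it was never
red or dies first. -/
def blueFrom (v : TreeVertex d) (r b : ℝ≥0∞) : ℝ≥0∞ :=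
  if r < ⊤ ∧ b + chaseWait ω v < r + lifeWait rho ω v then b + chaseWait ω v else ⊤

/-- The pair (time at which `v` turns red, time at which `v` turns blue), `⊤` standing for never.
The root is red and the extra vertex is blue at time `0`.  A vertex `i :: p` turns red when the
clock of its edge, started when `p` turns red, rings while `p` is still red, that is before `p` turns
blue and before `p` dies. -/
def colorTimes : TreeVertex d → ℝ≥0∞ × ℝ≥0∞
  | [] => (0, blueFrom rho ω [] 0 0)
  | i :: p =>
    let t := (colorTimes p).1 + spreadWait lam ω (i :: p)
    let r := if t < (colorTimes p).2 ∧ t < (colorTimes p).1 + lifeWait rho ω p then t else ⊤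
    (r, blueFrom rho ω (i :: p) r (colorTimes p).2)

/-- The time at which `v` turns red (`⊤` if never). -/
def redTime (v : TreeVertex d) : ℝ≥0∞ := (colorTimes lam rho ω v).1

/-- The time at which `v` turns blue (`⊤` if never). -/
def blueTime (v : TreeVertex d) : ℝ≥0∞ := (colorTimes lam rho ω v).2

open Classical in
/-- The state of each site at time `t` in chase-escape with death with spreading rate `lam` of red,
spreading rate `1` of blue and death rate `rho` (ordinary chase-escape if `rho = 0`), started from a
red root, a blue extra vertex and all other vertices white. -/
def state (t : ℝ≥0) : Site d → State
  | none => State.blue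
  | some v =>
    if (t : ℝ≥0∞) < redTime lam rho ω v then State.white
    else if blueTime lam rho ω v ≤ t then State.blue
    else if redTime lam rho ω v + lifeWait rho ω v ≤ t then State.dead
    else State.red

/-- The (random) set of sites that are ever blue, including the extra blue vertex. -/
def blueSites : Set (Site d) := {x | ∃ t : ℝ≥0, state lam rho ω t x = State.blue}

end Dynamics

/-- The probability that blue occupies infinitely many sites. -/
def coexistenceProb (d : ℕ) (lam rho : ℝ) : ℝ≥0∞ :=
  clockLaw d {ω | (blueSites lam rho ω).Infinite}

/-- The expected number of sites that are ever blue, with value `⊤` if infinite. -/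
def expectedBlue (d : ℕ) (lam rho : ℝ) : ℝ≥0∞ :=
  ∫⁻ ω, ((blueSites lam rho ω).encard : ℝ≥0∞) ∂(clockLaw d)

/-- The critical death rate for coexistence. -/
def rhoC (d : ℕ) (lam : ℝ) : ℝ :=
  sInf {rho : ℝ | 0 ≤ rho ∧ coexistenceProb d lam rho = 0}

/-- `λ_c⁻`, the critical rate of ordinary chase-escape on the `d`-ary tree. -/
def lamMinus (d : ℕ) : ℝ := 2 * d - 1 - 2 * √((d : ℝ) ^ 2 - d)

/-- `λ_c⁺`. -/
def lamPlus (d : ℕ) : ℝ := 2 * d - 1 + 2 * √((d : ℝ) ^ 2 - d)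

/-- The interval `Λ = (λ_c⁻, λ_c⁺)`. -/
def Lam (d : ℕ) : Set ℝ := Set.Ioo (lamMinus d) (lamPlus d)

end ChaseEscape

end

/-!
Blueness of a vertex `v` is decided along the path from the root to `v`. The *gap* of a vertex is
the time between its turning red and its turning blue; if a vertex has gap `x`, then a child that
turns red after a waiting time `s < x` has gap `x - s + c`, where `c` is its chase clock, and a
vertex turns blue iff it outlives its gap. So the gaps along a path form a Markov chain with
killing, the subtrees of siblings are independent given the gap of their parent, and
`E|B| = 1 + ∑ n, d ^ n * ∫ pathProb n`, where `pathProb n` is an iterate of the transfer operator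
`T` of this chain (`clockLaw_good`, `expectedBlue_eq`).

Write `w` for the survival factor `exp (-rho * x)`. An integrable supersolution
`h ≥ 1 + d * T (w * h)` makes the expectation finite (`expectedBlue_lt_top`), and a nontrivial
bounded subsolution `φ ≤ d * T (w * φ)` makes it infinite (`expectedBlue_eq_top`). For `rho > 0`
exactly one of the two is available. Indeed `T` inverts a second order differential operator, and
the equation `W = d * T (w * W)` has, up to its boundary condition `W 0 = 0`, an explicit solution
of Bessel type which decays at infinity and is positive there (`exists_decaying_solution`). If `W`
has no zero on `[0, ∞)`, then a multiple of `W` plus a constant is a bounded supersolution;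
otherwise the restriction of `W` to the right of its largest zero is a subsolution
(`exists_supersolution_or_subsolution`).

It remains to relate this dichotomy to the critical rate.
* A subsolution at `rho` forces coexistence at every `rho' < rho`, because the probability `S n`
  of reaching level `n` satisfies `S (n + 1) = w * (1 - (1 - T (S n)) ^ d)`, and a small multiple
  of `w * φ` stays below all `S n` (`coexistenceProb_ne_zero_of_subsolution`). Hence there is a
  supersolution at every `rho > rhoC`.
* A bounded supersolution survives a small decrease of `rho > 0`
  (`exists_lt_expectedBlue_lt_top`), so at `rho = rhoC > 0` there can only be a subsolution. If
  `rhoC = 0`, the equation has constant coefficients, and for `lam ∈ Λ` an arch of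
  `exp (α * x) * sin (ω * x)` is a subsolution (`expectedBlue_zero_eq_top`).

For `rho = 0` and `lam = λ_c⁻` the characteristic roots coincide, and an explicit unbounded, but
integrable, supersolution exists (`expectedBlue_zero_lt_top`).
-/

namespace ChaseEscape

/-! ### Independence of the subtrees below the root -/

/-- A product measure over a disjoint union of index sets splits into two independent parts. -/
theorem measurePreserving_infinitePi_sum {α β X : Type*} [MeasurableSpace X] (μ : Measure X)
    [IsProbabilityMeasure μ] :
    MeasurePreserving (fun ω : α ⊕ β → X => (fun a => ω (Sum.inl a), fun b => ω (Sum.inr b)))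
      (Measure.infinitePi fun _ => μ)
      ((Measure.infinitePi fun _ => μ).prod (Measure.infinitePi fun _ => μ)) := by
  have hm : Measurable fun z : (α → X) × (β → X) => (Sum.elim z.1 z.2 : α ⊕ β → X) := by
    rw [measurable_pi_iff]
    rintro (a | b)
    · exact (measurable_pi_apply a).comp measurable_fst
    · exact (measurable_pi_apply b).comp measurable_snd
  have key : ((Measure.infinitePi fun _ : α => μ).prod (Measure.infinitePi fun _ : β => μ)).map
      (fun z => (Sum.elim z.1 z.2 : α ⊕ β → X)) = Measure.infinitePi fun _ => μ := by
    refine Measure.eq_infinitePi _ fun s t ht => ?_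
    rw [Measure.map_apply hm (MeasurableSet.pi s.countable_toSet fun i _ => ht i)]
    have hbox : (fun z : (α → X) × (β → X) => (Sum.elim z.1 z.2 : α ⊕ β → X)) ⁻¹'
        (Set.pi s t) = (Set.pi (s.toLeft : Set α) fun a => t (Sum.inl a)) ×ˢ
          (Set.pi (s.toRight : Set β) fun b => t (Sum.inr b)) := by
      ext z
      simp [Set.mem_pi]
    rw [hbox, Measure.prod_prod, Measure.infinitePi_pi _ fun a _ => ht _,
      Measure.infinitePi_pi _ fun b _ => ht _]
    conv_rhs => rw [← Finset.toLeft_disjSum_toRight (u := s)]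
    rw [Finset.prod_disjSum]
  refine ⟨by fun_prop, ?_⟩
  rw [← key, Measure.map_map (by fun_prop) hm]
  exact Measure.map_id

/-- The clocks of the subtree rooted at the child `i` of the root.  Words grow at their head, so
the descendants of that child are the words that end in `i`. -/
def subtree {d : ℕ} (i : Fin d) (ω : Clocks d) : Clocks d := fun q => ω (q.1 ++ [i], q.2)

instance (d : ℕ) : IsProbabilityMeasure (clockLaw d) := by
  unfold clockLaw; infer_instance

/-- The clocks at the root and those of the subtrees of its children are independent; each subtree
carries a copy of the law of all clocks. -/
theorem measurePreserving_root_subtrees (d : ℕ) :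
    MeasurePreserving (fun ω : Clocks d => (fun k => ω ([], k), fun i => subtree i ω)) (clockLaw d)
      ((Measure.infinitePi fun _ : ClockKind => expMeasure 1).prod
        (Measure.pi fun _ : Fin d => clockLaw d)) := by
  let e : ClockKind ⊕ (Fin d × (TreeVertex d × ClockKind)) → TreeVertex d × ClockKind :=
    Sum.elim (fun k => ([], k)) (fun q => (q.2.1 ++ [q.1], q.2.2))
  have he : Function.Injective e := by
    rintro (k | ⟨i, p, k⟩) (k' | ⟨i', p', k'⟩) h <;>
      simp only [e, Sum.elim_inl, Sum.elim_inr, Prod.mk.injEq] at h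
    · rw [h.2]
    · exact absurd h.1.symm (by simp)
    · exact absurd h.1 (by simp)
    · obtain ⟨h1, h2⟩ := List.append_inj' h.1 rfl
      simp only [List.cons.injEq, and_true] at h2
      rw [h1, h2, h.2]
  have h1 : MeasurePreserving (fun (ω : Clocks d) a => ω (e a)) (clockLaw d)
      (Measure.infinitePi fun _ => expMeasure 1) :=
    ⟨by fun_prop, Measure.map_infinitePi_infinitePi_of_inj
      (P := fun _ : TreeVertex d × ClockKind => expMeasure 1) he⟩
  have h2 : MeasurePreserving (MeasurableEquiv.curry (Fin d) (TreeVertex d × ClockKind) ℝ)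
      (Measure.infinitePi fun _ => expMeasure 1) (Measure.pi fun _ : Fin d => clockLaw d) := by
    refine ⟨by fun_prop, ?_⟩
    rw [← Measure.infinitePi_eq_pi]
    exact Measure.infinitePi_map_curry (X := ℝ)
      (fun (_ : Fin d) (_ : TreeVertex d × ClockKind) => expMeasure 1)
  exact (((MeasurePreserving.id _).prod h2).comp
    (measurePreserving_infinitePi_sum (expMeasure 1))).comp h1

theorem measurePreserving_rootClocks :
    MeasurePreserving (fun r : ClockKind → ℝ => ((r .spread, r .chase), r .death))
      (Measure.infinitePi fun _ : ClockKind => expMeasure 1)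
      (((expMeasure 1).prod (expMeasure 1)).prod (expMeasure 1)) := by
  have hi : iIndepFun (fun (k : ClockKind) (r : ClockKind → ℝ) => r k)
      (Measure.infinitePi fun _ : ClockKind => expMeasure 1) :=
    iIndepFun_infinitePi (X := fun _ x => x) fun _ => measurable_id
  have hm (k : ClockKind) : Measurable fun r : ClockKind → ℝ => r k := measurable_pi_apply k
  have he (k : ClockKind) : (Measure.infinitePi fun _ : ClockKind => expMeasure 1).map
      (fun r => r k) = expMeasure 1 :=
    Measure.infinitePi_map_eval (fun _ : ClockKind => expMeasure 1) k
  have h1 := (hi.indepFun_prodMk hm ClockKind.spread ClockKind.chase ClockKind.death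
    (by simp) (by simp)).map_prod_eq_prod_map_map (by fun_prop) (hm _).aemeasurable
  have h2 := (hi.indepFun (show ClockKind.spread ≠ ClockKind.chase by simp)
    ).map_prod_eq_prod_map_map (hm _).aemeasurable (hm _).aemeasurable
  refine ⟨by fun_prop, ?_⟩
  rw [h1, h2, he, he, he]

/-- The joint law of the three clocks at the root and of the subtrees. -/
theorem measurePreserving_split (d : ℕ) :
    MeasurePreserving (fun ω : Clocks d =>
        (((ω ([], .spread), ω ([], .chase)), ω ([], .death)), fun i => subtree i ω)) (clockLaw d)
      ((((expMeasure 1).prod (expMeasure 1)).prod (expMeasure 1)).prod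
        (Measure.pi fun _ : Fin d => clockLaw d)) :=
  (measurePreserving_rootClocks.prod (MeasurePreserving.id _)).comp
    (measurePreserving_root_subtrees d)

/-! ### Gaps along a path -/

section Gap

variable {d : ℕ} (lam rho : ℝ)

/-- The gap at `v`, the time between `v` turning red and `v` turning blue when no death interferes,
as a function of the gap `x` at the root. -/
noncomputable def gap (x : ℝ) (ω : Clocks d) : TreeVertex d → ℝ
  | [] => x
  | i :: p => gap x ω p - ω (i :: p, .spread) / lam + ω (i :: p, .chase)

/-- The vertex `v` is ever blue if the gap at the root is `x`: on the way to `v`, red escapes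
from each vertex before blue arrives there, and each vertex outlives its gap. -/
def Good (x : ℝ) (ω : Clocks d) : TreeVertex d → Prop
  | [] => rho * x < ω ([], .death)
  | i :: p => Good x ω p ∧ ω (i :: p, .spread) < lam * gap lam x ω p ∧
      rho * gap lam x ω (i :: p) < ω (i :: p, .death)

theorem gap_append (x : ℝ) (ω : Clocks d) (p : TreeVertex d) (i : Fin d) :
    gap lam x ω (p ++ [i]) =
      gap lam (x - subtree i ω ([], .spread) / lam + subtree i ω ([], .chase)) (subtree i ω) p := by
  induction p with
  | nil => simp [gap, subtree]
  | cons j p ih =>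
    rw [List.cons_append, gap, ih]
    rfl

theorem good_append (x : ℝ) (ω : Clocks d) (p : TreeVertex d) (i : Fin d) :
    Good lam rho x ω (p ++ [i]) ↔ rho * x < ω ([], .death) ∧
      subtree i ω ([], .spread) < lam * x ∧
      Good lam rho (x - subtree i ω ([], .spread) / lam + subtree i ω ([], .chase))
        (subtree i ω) p := by
  induction p with
  | nil => simp [Good, gap, subtree]
  | cons j p ih =>
    rw [List.cons_append, Good, ih, gap_append, ← List.cons_append, gap_append, Good]
    simp only [and_assoc]
    rfl

theorem measurable_gap (v : TreeVertex d) :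
    Measurable fun z : ℝ × Clocks d => gap lam z.1 z.2 v := by
  induction v with
  | nil => exact measurable_fst
  | cons i p ih =>
    exact (ih.sub (((measurable_pi_apply _).comp measurable_snd).div_const _)).add
      ((measurable_pi_apply _).comp measurable_snd)

theorem measurableSet_good (v : TreeVertex d) :
    MeasurableSet {z : ℝ × Clocks d | Good lam rho z.1 z.2 v} := by
  induction v with
  | nil =>
    exact measurableSet_lt (measurable_fst.const_mul _)
      ((measurable_pi_apply _).comp measurable_snd)
  | cons i p ih =>
    exact ih.inter ((measurableSet_lt ((measurable_pi_apply _).comp measurable_snd)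
      ((measurable_gap lam p).const_mul _)).inter
      (measurableSet_lt ((measurable_gap lam (i :: p)).const_mul _)
        ((measurable_pi_apply _).comp measurable_snd)))

end Gap

/-! ### Comparison of the dynamics with the gaps -/

theorem ofReal_add_lt_add_waiting {r y e rho : ℝ} (hr : 0 ≤ r) (hy : 0 ≤ y) (he : 0 < e)
    (hrho : 0 ≤ rho) :
    ENNReal.ofReal (r + y) < ENNReal.ofReal r + waiting e rho ↔ rho * y < e := by
  rcases hrho.eq_or_lt with rfl | hpos
  · have : waiting e 0 = ⊤ := by
      rw [waiting, ENNReal.ofReal_zero, ENNReal.div_zero (ENNReal.ofReal_pos.2 he).ne']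
    simp [this, he]
  · rw [waiting, ← ENNReal.ofReal_div_of_pos hpos, ← ENNReal.ofReal_add hr (by positivity),
      ENNReal.ofReal_lt_ofReal_iff_of_nonneg (by positivity), add_lt_add_iff_left, lt_div_iff₀ hpos,
      mul_comm]

/-- While `v` is good, its red and blue times differ by the gap; otherwise `v` is never blue. -/
theorem colorTimes_of_pos {d : ℕ} {lam rho : ℝ} (hlam : 0 < lam) (hrho : 0 ≤ rho) {ω : Clocks d}
    (hω : ∀ a, 0 < ω a) (v : TreeVertex d) :
    (Good lam rho (ω ([], .chase)) ω v ∧ 0 < gap lam (ω ([], .chase)) ω v ∧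
      ∃ r : ℝ, 0 ≤ r ∧ (colorTimes lam rho ω v).1 = ENNReal.ofReal r ∧
        (colorTimes lam rho ω v).2 = ENNReal.ofReal (r + gap lam (ω ([], .chase)) ω v)) ∨
    (¬ Good lam rho (ω ([], .chase)) ω v ∧ (colorTimes lam rho ω v).2 = ⊤) := by
  induction v with
  | nil =>
    have h := ofReal_add_lt_add_waiting le_rfl (hω ([], .chase)).le (hω ([], .death)) hrho
    simp only [ENNReal.ofReal_zero, zero_add] at h
    simp only [colorTimes, blueFrom, chaseWait, lifeWait, Good, gap, zero_add]
    have hc : waiting (ω ([], .chase)) 1 = ENNReal.ofReal (ω ([], .chase)) := by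
      simp [waiting]
    rw [hc]
    by_cases hg : rho * ω ([], .chase) < ω ([], .death)
    · refine Or.inl ⟨hg, hω _, 0, le_rfl, by simp, ?_⟩
      rw [if_pos ⟨by simp, h.2 hg⟩, zero_add]
    · exact Or.inr ⟨hg, if_neg fun hh => hg (h.1 hh.2)⟩
  | cons i p ih =>
    set x := ω ([], .chase)
    rcases ih with ⟨hgood, hgap, r, hr, hred, hblue⟩ | ⟨hbad, hblue⟩
    · have hs : spreadWait lam ω (i :: p) = ENNReal.ofReal (ω (i :: p, .spread) / lam) := by
        rw [spreadWait, waiting, ← ENNReal.ofReal_div_of_pos hlam]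
      have hs0 : 0 < ω (i :: p, .spread) / lam := div_pos (hω _) hlam
      have hc : chaseWait ω (i :: p) = ENNReal.ofReal (ω (i :: p, .chase)) := by
        simp [chaseWait, waiting]
      have hlife : rho * gap lam x ω p < ω (p, .death) := by
        cases p with
        | nil => exact hgood
        | cons j q => exact hgood.2.2
      have hbl : ENNReal.ofReal (r + gap lam x ω p) < ENNReal.ofReal r + lifeWait rho ω p :=
        (ofReal_add_lt_add_waiting hr hgap.le (hω _) hrho).2 hlife
      simp only [colorTimes, hred, hblue, hs, ← ENNReal.ofReal_add hr hs0.le]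
      by_cases hsp : ω (i :: p, .spread) < lam * gap lam x ω p
      · have hsp' : ω (i :: p, .spread) / lam < gap lam x ω p := by
          rwa [div_lt_iff₀ hlam, mul_comm]
        have hlt : ENNReal.ofReal (r + ω (i :: p, .spread) / lam) <
            ENNReal.ofReal (r + gap lam x ω p) := by
          rw [ENNReal.ofReal_lt_ofReal_iff_of_nonneg (by positivity)]
          linarith
        rw [if_pos ⟨hlt, hlt.trans hbl⟩]
        have hnew : 0 < gap lam x ω (i :: p) := by
          have := hω (i :: p, .chase)
          rw [gap]
          linarith
        have hb : ENNReal.ofReal (r + gap lam x ω p) + chaseWait ω (i :: p) =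
            ENNReal.ofReal (r + ω (i :: p, .spread) / lam + gap lam x ω (i :: p)) := by
          rw [hc, ← ENNReal.ofReal_add (by positivity) (hω _).le, gap]
          congr 1
          ring
        have hiff := ofReal_add_lt_add_waiting (r := r + ω (i :: p, .spread) / lam)
          (by positivity) hnew.le (hω (i :: p, .death)) hrho
        simp only [blueFrom, hb]
        by_cases hg : rho * gap lam x ω (i :: p) < ω (i :: p, .death)
        · refine Or.inl ⟨⟨hgood, hsp, hg⟩, hnew, _, by positivity, rfl, ?_⟩
          exact if_pos ⟨ENNReal.ofReal_lt_top, hiff.2 hg⟩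
        · exact Or.inr ⟨fun h => hg h.2.2, if_neg fun h => hg (hiff.1 h.2)⟩
      · refine Or.inr ⟨fun h => hsp h.2.1, ?_⟩
        have hle : ¬ ENNReal.ofReal (r + ω (i :: p, .spread) / lam) <
            ENNReal.ofReal (r + gap lam x ω p) := by
          rw [ENNReal.ofReal_lt_ofReal_iff_of_nonneg (by positivity), not_lt,
            add_le_add_iff_left, le_div_iff₀ hlam, mul_comm]
          exact not_lt.1 hsp
        rw [if_neg fun h => hle h.1, blueFrom, if_neg fun h => lt_irrefl _ h.1]
    · refine Or.inr ⟨fun h => hbad h.1, ?_⟩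
      simp [colorTimes, hblue, blueFrom]

theorem blueSites_eq {d : ℕ} {lam rho : ℝ} (hlam : 0 < lam) (hrho : 0 ≤ rho) {ω : Clocks d}
    (hω : ∀ a, 0 < ω a) :
    blueSites lam rho ω = insert none (some '' {v | Good lam rho (ω ([], .chase)) ω v}) := by
  ext (_ | v)
  · simp [blueSites, state]
  · have hv : (∃ t : ℝ≥0, state lam rho ω t (some v) = State.blue) ↔
        ∃ t : ℝ≥0, redTime lam rho ω v ≤ t ∧ blueTime lam rho ω v ≤ t := by
      refine exists_congr fun t => ?_
      simp only [state]
      split_ifs with h1 h2 h3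
      · simp [h1]
      · simp [not_lt.1 h1, h2]
      · simp [h2]
      · simp [h2]
    simp only [blueSites, Set.mem_ofPred_eq, hv, Set.mem_insert_iff, reduceCtorEq, Set.mem_image,
      Option.some.injEq, exists_eq_right, false_or]
    rcases colorTimes_of_pos hlam hrho hω v with ⟨hg, hgap, r, hr, h1, h2⟩ | ⟨hg, h2⟩
    · refine iff_of_true ⟨(r + gap lam (ω ([], .chase)) ω v).toNNReal, ?_, ?_⟩ hg
      · rw [redTime, h1]
        exact ENNReal.ofReal_le_ofReal (by linarith)
      · rw [blueTime, h2]
        exact le_rfl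
    · refine iff_of_false ?_ hg
      rintro ⟨t, -, h⟩
      rw [blueTime, h2, top_le_iff] at h
      exact ENNReal.coe_ne_top h

/-! ### The transfer operator and the law of the blue sites -/

/-- The transfer operator from a vertex to its child: `transfer lam f x` is the expectation of
`f` at the gap of the child of a vertex with gap `x`, on the event that the child turns red. -/
noncomputable def transfer (lam : ℝ) (f : ℝ → ℝ≥0∞) (x : ℝ) : ℝ≥0∞ :=
  ∫⁻ z, (if z.1 < lam * x then f (x - z.1 / lam + z.2) else 0) ∂(expMeasure 1).prod (expMeasure 1)

/-- The probability that a vertex with gap `x` lives longer than its gap. -/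
noncomputable def outlive (rho x : ℝ) : ℝ≥0∞ := expMeasure 1 (Set.Ioi (rho * x))

/-- The probability that a given vertex of level `n` is ever blue if the gap at the root is `x`. -/
noncomputable def pathProb (lam rho : ℝ) : ℕ → ℝ → ℝ≥0∞
  | 0 => outlive rho
  | n + 1 => fun x => outlive rho x * transfer lam (pathProb lam rho n) x

theorem measurable_transfer {lam : ℝ} {f : ℝ → ℝ≥0∞} (hf : Measurable f) :
    Measurable (transfer lam f) := by
  unfold transfer
  refine Measurable.lintegral_prod_right' (f := fun q : ℝ × (ℝ × ℝ) =>
    if q.2.1 < lam * q.1 then f (q.1 - q.2.1 / lam + q.2.2) else 0) ?_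
  refine Measurable.ite (measurableSet_lt (by fun_prop) (by fun_prop)) ?_ measurable_const
  exact hf.comp (by fun_prop)

theorem measurable_outlive (rho : ℝ) : Measurable (outlive rho) := by
  have h : MeasurableSet {q : ℝ × ℝ | rho * q.1 < q.2} :=
    measurableSet_lt (by fun_prop) (by fun_prop)
  have h' : Measurable fun x => expMeasure 1 (Prod.mk x ⁻¹' {q : ℝ × ℝ | rho * q.1 < q.2}) :=
    measurable_measure_prodMk_left h
  exact h'

theorem measurable_pathProb (lam rho : ℝ) (n : ℕ) : Measurable (pathProb lam rho n) := by
  induction n with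
  | zero => exact measurable_outlive rho
  | succ n ih => exact (measurable_outlive rho).mul (measurable_transfer ih)

/-- An event about a gap and the clocks that ignores the spread and chase clocks of the root. -/
def IsTailEvent {d : ℕ} (A : Set (ℝ × Clocks d)) : Prop :=
  ∃ B : Set (ℝ × (ℝ × (Fin d → Clocks d))), MeasurableSet B ∧
    A = (fun z => (z.1, (z.2 ([], .death), fun i => subtree i z.2))) ⁻¹' B

/-- The event that the root turns red from a parent with gap `x` and that `A` then holds with the
gap of the root. -/
def stepEvent {d : ℕ} (lam : ℝ) (A : Set (ℝ × Clocks d)) : Set (ℝ × Clocks d) :=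
  {z | z.2 ([], .spread) < lam * z.1 ∧
    (z.1 - z.2 ([], .spread) / lam + z.2 ([], .chase), z.2) ∈ A}

theorem measurable_clock {d : ℕ} (a : TreeVertex d × ClockKind) :
    Measurable fun z : ℝ × Clocks d => z.2 a :=
  (measurable_pi_apply a).comp measurable_snd

theorem measurableSet_stepEvent {d : ℕ} (lam : ℝ) {A : Set (ℝ × Clocks d)}
    (hA : MeasurableSet A) : MeasurableSet (stepEvent lam A) := by
  have h1 : MeasurableSet {z : ℝ × Clocks d | z.2 ([], .spread) < lam * z.1} :=
    measurableSet_lt (measurable_clock _) (measurable_fst.const_mul _)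
  have h2 : Measurable fun z : ℝ × Clocks d =>
      (z.1 - z.2 ([], .spread) / lam + z.2 ([], .chase), z.2) :=
    ((measurable_fst.sub ((measurable_clock _).div_const _)).add
      (measurable_clock _)).prodMk measurable_snd
  exact h1.inter (h2 hA)

theorem IsTailEvent.clockLaw_eq {d : ℕ} {B : Set (ℝ × (ℝ × (Fin d → Clocks d)))}
    (hB : MeasurableSet B) (y : ℝ) :
    clockLaw d {ω | (y, ω) ∈ (fun z : ℝ × Clocks d =>
        (z.1, (z.2 ([], .death), fun i => subtree i z.2))) ⁻¹' B} =
      ((expMeasure 1).prod (Measure.pi fun _ : Fin d => clockLaw d)) (Prod.mk y ⁻¹' B) := by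
  have h := (((measurePreserving_snd (μ := (expMeasure 1).prod (expMeasure 1))
    (ν := expMeasure 1)).prod (MeasurePreserving.id (Measure.pi fun _ : Fin d => clockLaw d))).comp
    (measurePreserving_split d)).measure_preimage
    ((hB.preimage measurable_prodMk_left).nullMeasurableSet (s := Prod.mk y ⁻¹' B))
  rw [← h]
  rfl

/-- The gap at the root is independent of any tail event. -/
theorem IsTailEvent.clockLaw_stepEvent {d : ℕ} {lam : ℝ} {A : Set (ℝ × Clocks d)}
    (hA : IsTailEvent A) (x : ℝ) :
    clockLaw d {ω | (x, ω) ∈ stepEvent lam A} =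
      transfer lam (fun y => clockLaw d {ω | (y, ω) ∈ A}) x := by
  obtain ⟨B, hB, rfl⟩ := hA
  simp only [IsTailEvent.clockLaw_eq hB]
  set ν := Measure.pi fun _ : Fin d => clockLaw d
  let C : Set (((ℝ × ℝ) × ℝ) × (Fin d → Clocks d)) :=
    {q | q.1.1.1 < lam * x ∧ (x - q.1.1.1 / lam + q.1.1.2, (q.1.2, q.2)) ∈ B}
  have hC : MeasurableSet C := by
    have hC1 : MeasurableSet {q : ((ℝ × ℝ) × ℝ) × (Fin d → Clocks d) | q.1.1.1 < lam * x} :=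
      measurableSet_lt (by fun_prop) (by fun_prop)
    have hC2 : Measurable fun q : ((ℝ × ℝ) × ℝ) × (Fin d → Clocks d) =>
        (x - q.1.1.1 / lam + q.1.1.2, (q.1.2, q.2)) := by fun_prop
    exact hC1.inter (hC2 hB)
  have h1 := (measurePreserving_split d).measure_preimage hC.nullMeasurableSet
  have h2 := (measurePreserving_prodAssoc ((expMeasure 1).prod (expMeasure 1)) (expMeasure 1)
    ν).symm.measure_preimage hC.nullMeasurableSet
  have h3 : clockLaw d {ω | (x, ω) ∈ stepEvent lam ((fun z : ℝ × Clocks d =>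
        (z.1, (z.2 ([], .death), fun i => subtree i z.2))) ⁻¹' B)} =
      (((expMeasure 1).prod (expMeasure 1)).prod ((expMeasure 1).prod ν))
        (MeasurableEquiv.prodAssoc.symm ⁻¹' C) := by
    rw [h2, ← h1]
    rfl
  rw [h3, Measure.prod_apply (hC.preimage (by fun_prop)), transfer]
  refine lintegral_congr fun z => ?_
  split_ifs with hz
  · congr 1
    ext q
    simp [C, MeasurableEquiv.prodAssoc, hz]
  · rw [show Prod.mk z ⁻¹' (MeasurableEquiv.prodAssoc.symm ⁻¹' C) = ∅ by
      ext q
      simp [C, MeasurableEquiv.prodAssoc, hz], measure_empty]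

/-- The event that, with gap `x` at the root, some vertex of level `n` is ever blue. -/
def reachEvent (d : ℕ) (lam rho : ℝ) (n : ℕ) : Set (ℝ × Clocks d) :=
  {z | ∃ v : TreeVertex d, v.length = n ∧ Good lam rho z.1 z.2 v}

theorem setOf_good_append {d : ℕ} (lam rho : ℝ) (p : TreeVertex d) (i : Fin d) :
    {z : ℝ × Clocks d | Good lam rho z.1 z.2 (p ++ [i])} =
      {z | rho * z.1 < z.2 ([], .death) ∧
        (z.1, subtree i z.2) ∈ stepEvent lam {z | Good lam rho z.1 z.2 p}} := by
  ext z
  exact good_append lam rho z.1 z.2 p i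

theorem reachEvent_succ (d : ℕ) (lam rho : ℝ) (n : ℕ) :
    reachEvent d lam rho (n + 1) = {z | rho * z.1 < z.2 ([], .death) ∧
        ∃ i, (z.1, subtree i z.2) ∈ stepEvent lam (reachEvent d lam rho n)} := by
  ext z
  constructor
  · rintro ⟨v, hv, hg⟩
    rcases List.eq_nil_or_concat' v with rfl | ⟨p, i, rfl⟩
    · simp at hv
    · obtain ⟨h1, h2, h3⟩ := (good_append lam rho z.1 z.2 p i).1 hg
      exact ⟨h1, i, h2, p, by simpa using hv, h3⟩
  · rintro ⟨h1, i, h2, p, hp, h3⟩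
    exact ⟨p ++ [i], by simpa using hp, (good_append lam rho z.1 z.2 p i).2 ⟨h1, h2, h3⟩⟩

theorem isTailEvent_nil (d : ℕ) (rho : ℝ) :
    IsTailEvent {z : ℝ × Clocks d | rho * z.1 < z.2 ([], .death)} :=
  ⟨{q | rho * q.1 < q.2.1}, measurableSet_lt (by fun_prop) (by fun_prop), rfl⟩

theorem isTailEvent_good {d : ℕ} (lam rho : ℝ) (v : TreeVertex d) :
    IsTailEvent {z : ℝ × Clocks d | Good lam rho z.1 z.2 v} := by
  rcases List.eq_nil_or_concat' v with rfl | ⟨p, i, rfl⟩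
  · exact isTailEvent_nil d rho
  · rw [setOf_good_append]
    refine ⟨{q | rho * q.1 < q.2.1 ∧
      (q.1, q.2.2 i) ∈ stepEvent lam {z | Good lam rho z.1 z.2 p}}, ?_, rfl⟩
    have h1 : MeasurableSet {q : ℝ × (ℝ × (Fin d → Clocks d)) | rho * q.1 < q.2.1} :=
      measurableSet_lt (by fun_prop) (by fun_prop)
    have h2 : Measurable fun q : ℝ × (ℝ × (Fin d → Clocks d)) => (q.1, q.2.2 i) := by fun_prop
    exact h1.inter (h2 (measurableSet_stepEvent lam (measurableSet_good lam rho p)))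

theorem measurableSet_reachEvent (d : ℕ) (lam rho : ℝ) (n : ℕ) :
    MeasurableSet (reachEvent d lam rho n) := by
  have : reachEvent d lam rho n = ⋃ v : TreeVertex d, ⋃ _ : v.length = n,
      {z | Good lam rho z.1 z.2 v} := by
    ext z
    simp [reachEvent]
  rw [this]
  exact MeasurableSet.iUnion fun v => MeasurableSet.iUnion fun _ => measurableSet_good lam rho v

theorem isTailEvent_reachEvent (d : ℕ) (lam rho : ℝ) (n : ℕ) :
    IsTailEvent (reachEvent d lam rho n) := by
  cases n with
  | zero =>
    convert! isTailEvent_nil d rho using 1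
    ext z
    simp [reachEvent, Good]
  | succ n =>
    rw [reachEvent_succ]
    refine ⟨{q | rho * q.1 < q.2.1 ∧
      ∃ i, (q.1, q.2.2 i) ∈ stepEvent lam (reachEvent d lam rho n)}, ?_, rfl⟩
    have h1 : MeasurableSet {q : ℝ × (ℝ × (Fin d → Clocks d)) | rho * q.1 < q.2.1} :=
      measurableSet_lt (by fun_prop) (by fun_prop)
    have h2 (i : Fin d) : Measurable fun q : ℝ × (ℝ × (Fin d → Clocks d)) => (q.1, q.2.2 i) := by
      fun_prop
    have h3 : MeasurableSet {q : ℝ × (ℝ × (Fin d → Clocks d)) |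
        ∃ i, (q.1, q.2.2 i) ∈ stepEvent lam (reachEvent d lam rho n)} := by
      rw [show {q : ℝ × (ℝ × (Fin d → Clocks d)) |
          ∃ i, (q.1, q.2.2 i) ∈ stepEvent lam (reachEvent d lam rho n)} =
        ⋃ i, (fun q => (q.1, q.2.2 i)) ⁻¹' stepEvent lam (reachEvent d lam rho n) by ext; simp]
      exact MeasurableSet.iUnion fun i =>
        h2 i (measurableSet_stepEvent lam (measurableSet_reachEvent d lam rho n))
    exact h1.inter h3

theorem clockLaw_death (d : ℕ) (rho x : ℝ) :
    clockLaw d {ω | rho * x < ω ([], .death)} = outlive rho x := by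
  have h := (measurePreserving_eval_infinitePi
    (fun _ : TreeVertex d × ClockKind => expMeasure 1) ([], .death)).measure_preimage
    (measurableSet_Ioi (a := rho * x)).nullMeasurableSet
  exact h

/-- The root's death clock is independent of the subtrees below its children. -/
theorem clockLaw_death_and (d : ℕ) (rho x : ℝ) {T : Set (Fin d → Clocks d)}
    (hT : MeasurableSet T) :
    clockLaw d {ω | rho * x < ω ([], .death) ∧ (fun i => subtree i ω) ∈ T} =
      outlive rho x * (Measure.pi fun _ : Fin d => clockLaw d) T := by
  have hs : MeasurableSet (Set.Ioi (rho * x) ×ˢ T) := measurableSet_Ioi.prod hT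
  have h := (((measurePreserving_snd (μ := (expMeasure 1).prod (expMeasure 1))
    (ν := expMeasure 1)).prod (MeasurePreserving.id (Measure.pi fun _ : Fin d => clockLaw d))).comp
    (measurePreserving_split d)).measure_preimage hs.nullMeasurableSet
  rw [Measure.prod_prod] at h
  exact h

/-- The probability that `v` is good depends only on the level of `v`. -/
theorem clockLaw_good {d : ℕ} (lam rho : ℝ) (v : TreeVertex d) (x : ℝ) :
    clockLaw d {ω | Good lam rho x ω v} = pathProb lam rho v.length x := by
  induction v using List.reverseRecOn generalizing x with
  | nil => exact clockLaw_death d rho x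
  | append_singleton p i ih =>
    have hm := measurableSet_stepEvent lam (measurableSet_good lam rho p)
    have hT : MeasurableSet {ω : Clocks d | (x, ω) ∈ stepEvent lam
        {z : ℝ × Clocks d | Good lam rho z.1 z.2 p}} := measurable_prodMk_left hm
    have h1 : {ω : Clocks d | Good lam rho x ω (p ++ [i])} =
        {ω | rho * x < ω ([], .death) ∧ (fun i => subtree i ω) ∈ Function.eval i ⁻¹'
          {ω : Clocks d | (x, ω) ∈ stepEvent lam {z : ℝ × Clocks d | Good lam rho z.1 z.2 p}}} := by
      ext ω
      exact good_append lam rho x ω p i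
    rw [h1, clockLaw_death_and d rho x (hT.preimage (measurable_pi_apply i)),
      (measurePreserving_eval (fun _ : Fin d => clockLaw d) i).measure_preimage
        hT.nullMeasurableSet,
      (isTailEvent_good lam rho p).clockLaw_stepEvent x]
    simp only [List.length_append, List.length_cons, List.length_nil, zero_add, pathProb]
    congr 2
    exact funext ih

theorem clockLaw_reachEvent_zero (d : ℕ) (lam rho x : ℝ) :
    clockLaw d {ω | (x, ω) ∈ reachEvent d lam rho 0} = outlive rho x := by
  rw [← clockLaw_death]
  congr 1
  ext ω
  simp [reachEvent, Good]

/-- The branching recursion: the children of a vertex with a given gap start independent and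
identically distributed subtrees. -/
theorem clockLaw_reachEvent_succ (d : ℕ) (lam rho : ℝ) (n : ℕ) (x : ℝ) :
    clockLaw d {ω | (x, ω) ∈ reachEvent d lam rho (n + 1)} = outlive rho x *
      (1 - (1 - transfer lam (fun y =>
        clockLaw d {ω | (y, ω) ∈ reachEvent d lam rho n}) x) ^ d) := by
  have hm := measurableSet_stepEvent lam (measurableSet_reachEvent d lam rho n)
  have hT : MeasurableSet {ω : Clocks d | (x, ω) ∈ stepEvent lam (reachEvent d lam rho n)} :=
    measurable_prodMk_left hm
  have hpi : MeasurableSet (Set.univ.pi fun _ : Fin d =>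
      {ω : Clocks d | (x, ω) ∈ stepEvent lam (reachEvent d lam rho n)}ᶜ) :=
    MeasurableSet.univ_pi fun _ => hT.compl
  rw [← (isTailEvent_reachEvent d lam rho n).clockLaw_stepEvent x]
  have h1 : {ω : Clocks d | (x, ω) ∈ reachEvent d lam rho (n + 1)} =
      {ω | rho * x < ω ([], .death) ∧ (fun i => subtree i ω) ∈
        (Set.univ.pi fun _ : Fin d =>
          {ω : Clocks d | (x, ω) ∈ stepEvent lam (reachEvent d lam rho n)}ᶜ)ᶜ} := by
    ext ω
    rw [reachEvent_succ]
    simp [Set.mem_pi]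
  rw [h1, clockLaw_death_and d rho x hpi.compl, prob_compl_eq_one_sub hpi, Measure.pi_pi,
    Finset.prod_const, Finset.card_univ, Fintype.card_fin, prob_compl_eq_one_sub hT]

/-- Averaging over the chase clock of the root, which is the gap at the root. -/
theorem IsTailEvent.clockLaw_chase {d : ℕ} {A : Set (ℝ × Clocks d)} (hA : IsTailEvent A) :
    clockLaw d {ω | (ω ([], .chase), ω) ∈ A} = ∫⁻ x, clockLaw d {ω | (x, ω) ∈ A} ∂expMeasure 1 := by
  obtain ⟨B, hB, rfl⟩ := hA
  simp only [IsTailEvent.clockLaw_eq hB]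
  set ν := Measure.pi fun _ : Fin d => clockLaw d
  have h1 := (((measurePreserving_prodAssoc (expMeasure 1) (expMeasure 1) ν).comp
    (((measurePreserving_snd (μ := expMeasure 1) (ν := expMeasure 1)).prod
    (MeasurePreserving.id (expMeasure 1))).prod (MeasurePreserving.id ν))).comp
    (measurePreserving_split d)).measure_preimage hB.nullMeasurableSet
  rw [← Measure.prod_apply hB, ← h1]
  rfl

theorem lintegral_expMeasure_one {f : ℝ → ℝ≥0∞} (hf : Measurable f) :
    ∫⁻ x, f x ∂expMeasure 1 = ∫⁻ x in Set.Ioi 0, ENNReal.ofReal (Real.exp (-x)) * f x := by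
  have h : expMeasure 1 = volume.withDensity (exponentialPDF 1) := rfl
  have hm : Measurable (exponentialPDF 1) := (measurable_exponentialPDFReal 1).ennreal_ofReal
  rw [h, lintegral_withDensity_eq_lintegral_mul _ hm hf,
    setLIntegral_congr (Ioi_ae_eq_Ici (μ := volume) (a := (0 : ℝ))),
    ← lintegral_indicator measurableSet_Ici]
  refine lintegral_congr fun x => ?_
  by_cases hx : 0 ≤ x
  · simp [hx, exponentialPDF_of_nonneg]
  · simp [hx, exponentialPDF_of_neg (not_le.1 hx)]

theorem expMeasure_one_ae_pos : ∀ᵐ x ∂expMeasure 1, 0 < x := by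
  have h := lintegral_expMeasure_one (f := (Set.Iic 0).indicator 1)
    (measurable_one.indicator measurableSet_Iic)
  rw [lintegral_indicator_one measurableSet_Iic] at h
  rw [ae_iff]
  simp only [not_lt]
  refine h.trans ?_
  rw [setLIntegral_congr_fun (g := fun _ => 0) measurableSet_Ioi, lintegral_zero]
  intro x hx
  simp [not_le.2 (Set.mem_Ioi.1 hx)]

instance : Finite ClockKind := by
  refine Finite.of_surjective (fun n : Fin 3 =>
    if n = 0 then ClockKind.spread else if n = 1 then ClockKind.chase else ClockKind.death) ?_
  rintro (_ | _ | _)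
  · exact ⟨0, by simp⟩
  · exact ⟨1, by simp⟩
  · exact ⟨2, by simp⟩

theorem clockLaw_ae_pos (d : ℕ) : ∀ᵐ ω ∂clockLaw d, ∀ a, 0 < ω a := by
  rw [ae_all_iff]
  intro a
  exact (measurePreserving_eval_infinitePi
    (fun _ : TreeVertex d × ClockKind => expMeasure 1) a).quasiMeasurePreserving.ae
    expMeasure_one_ae_pos

theorem measurableSet_good_chase {d : ℕ} (lam rho : ℝ) (v : TreeVertex d) :
    MeasurableSet {ω : Clocks d | Good lam rho (ω ([], .chase)) ω v} := by
  have h : Measurable fun ω : Clocks d => (ω ([], .chase), ω) :=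
    (measurable_pi_apply _).prodMk measurable_id
  exact h (measurableSet_good lam rho v)

/-- The number of blue sites as a sum of indicators. -/
theorem encard_blueSites {d : ℕ} {lam rho : ℝ} (hlam : 0 < lam) (hrho : 0 ≤ rho) {ω : Clocks d}
    (hω : ∀ a, 0 < ω a) :
    ((blueSites lam rho ω).encard : ℝ≥0∞) =
      1 + ∑' v : TreeVertex d,
        {ω : Clocks d | Good lam rho (ω ([], .chase)) ω v}.indicator 1 ω := by
  rw [blueSites_eq hlam hrho hω, Set.encard_insert_of_notMem (by simp),
    (Option.some_injective _).injOn.encard_image, add_comm, ENat.toENNReal_add,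
    ← ENNReal.tsum_set_one]
  simp only [ENat.toENNReal_one]
  congr 1
  rw [tsum_subtype {v | Good lam rho (ω ([], .chase)) ω v} (fun _ => (1 : ℝ≥0∞))]
  rfl

theorem tsum_list_length (d : ℕ) (f : ℕ → ℝ≥0∞) :
    ∑' v : List (Fin d), f v.length = ∑' n, (d : ℝ≥0∞) ^ n * f n := by
  rw [← (Equiv.sigmaFiberEquiv (List.length : List (Fin d) → ℕ)).tsum_eq, ENNReal.tsum_sigma']
  refine tsum_congr fun n => ?_
  have h : ∀ v : {l : List (Fin d) // l.length = n},
      f ((Equiv.sigmaFiberEquiv (List.length : List (Fin d) → ℕ)) ⟨n, v⟩).length = f n := by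
    intro v
    simp [Equiv.sigmaFiberEquiv, v.2]
  simp only [h]
  have hc : ENat.card (List.Vector (Fin d) n) = (d ^ n : ℕ) := by
    rw [ENat.card_eq_coe_fintype_card, card_vector, Fintype.card_fin]
  rw [ENNReal.tsum_const]
  change (ENat.card (List.Vector (Fin d) n) : ℝ≥0∞) * f n = _
  rw [hc]
  simp

theorem expectedBlue_eq {d : ℕ} {lam rho : ℝ} (hlam : 0 < lam) (hrho : 0 ≤ rho) :
    expectedBlue d lam rho =
      1 + ∑' n, (d : ℝ≥0∞) ^ n * ∫⁻ x, pathProb lam rho n x ∂expMeasure 1 := by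
  have h1 : expectedBlue d lam rho = ∫⁻ ω, 1 + ∑' v : TreeVertex d,
      {ω : Clocks d | Good lam rho (ω ([], .chase)) ω v}.indicator 1 ω ∂clockLaw d := by
    refine lintegral_congr_ae ?_
    filter_upwards [clockLaw_ae_pos d] with ω hω
    exact encard_blueSites hlam hrho hω
  have h2 (v : TreeVertex d) :
      ∫⁻ ω, {ω : Clocks d | Good lam rho (ω ([], .chase)) ω v}.indicator 1 ω ∂clockLaw d =
        ∫⁻ x, pathProb lam rho v.length x ∂expMeasure 1 := by
    rw [lintegral_indicator_one (measurableSet_good_chase lam rho v)]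
    simp only [← clockLaw_good]
    exact (isTailEvent_good lam rho v).clockLaw_chase
  rw [h1, lintegral_add_left measurable_const, lintegral_const, measure_univ, mul_one,
    lintegral_tsum fun v =>
      (measurable_one.indicator (measurableSet_good_chase lam rho v)).aemeasurable]
  simp only [h2]
  rw [tsum_list_length d fun n => ∫⁻ x, pathProb lam rho n x ∂expMeasure 1]

theorem coexistenceProb_eq_zero {d : ℕ} {lam rho : ℝ} (hlam : 0 < lam) (hrho : 0 ≤ rho)
    (h : expectedBlue d lam rho < ⊤) : coexistenceProb d lam rho = 0 := by
  have hae : (fun ω => ((blueSites lam rho ω).encard : ℝ≥0∞)) =ᵐ[clockLaw d] fun ω =>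
      1 + ∑' v : TreeVertex d,
        {ω : Clocks d | Good lam rho (ω ([], .chase)) ω v}.indicator 1 ω := by
    filter_upwards [clockLaw_ae_pos d] with ω hω
    exact encard_blueSites hlam hrho hω
  have hm : AEMeasurable (fun ω => ((blueSites lam rho ω).encard : ℝ≥0∞)) (clockLaw d) :=
    ⟨_, measurable_const.add (Measurable.tsum fun v =>
      measurable_one.indicator (measurableSet_good_chase lam rho v)), hae⟩
  have hfin := ae_lt_top' hm h.ne
  rw [coexistenceProb]
  refine measure_mono_null (fun ω hω => ?_) (ae_iff.1 hfin)
  have : (blueSites lam rho ω).encard = ⊤ := Set.encard_eq_top_iff.2 hω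
  change ¬ (_ < _)
  rw [this]
  simp

/-- Blue coexists as soon as the probabilities of reaching level `n` are bounded below, uniformly
in `n`, by a function of the root gap that is not almost surely zero. -/
theorem coexistenceProb_ne_zero {d : ℕ} {lam rho : ℝ} (hlam : 0 < lam) (hrho : 0 ≤ rho)
    {f : ℝ → ℝ≥0∞} (hf : ∫⁻ x, f x ∂expMeasure 1 ≠ 0)
    (hle : ∀ n, ∀ x, 0 < x → f x ≤ clockLaw d {ω | (x, ω) ∈ reachEvent d lam rho n}) :
    coexistenceProb d lam rho ≠ 0 := by
  let R : ℕ → Set (Clocks d) := fun n => {ω | (ω ([], .chase), ω) ∈ reachEvent d lam rho n}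
  have hRm (n : ℕ) : MeasurableSet (R n) := by
    have h : Measurable fun ω : Clocks d => (ω ([], .chase), ω) :=
      (measurable_pi_apply _).prodMk measurable_id
    exact h (measurableSet_reachEvent d lam rho n)
  have hR (n : ℕ) : ∫⁻ x, f x ∂expMeasure 1 ≤ clockLaw d (R n) := by
    rw [(isTailEvent_reachEvent d lam rho n).clockLaw_chase]
    refine lintegral_mono_ae ?_
    filter_upwards [expMeasure_one_ae_pos] with x hx using hle n x hx
  have hanti : Antitone R := by
    refine antitone_nat_of_succ_le fun n ω => ?_
    rintro ⟨v, hv, hg⟩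
    cases v with
    | nil => simp at hv
    | cons i p => exact ⟨p, by simpa using hv, hg.1⟩
  have hlim := tendsto_measure_iInter_atTop (μ := clockLaw d)
    (fun n => (hRm n).nullMeasurableSet) hanti ⟨0, measure_ne_top _ _⟩
  have hpos : ∫⁻ x, f x ∂expMeasure 1 ≤ clockLaw d (⋂ n, R n) :=
    ge_of_tendsto' hlim hR
  intro h0
  refine hf (le_antisymm (hpos.trans ?_) zero_le)
  rw [← h0, coexistenceProb]
  refine measure_mono_ae ?_
  filter_upwards [clockLaw_ae_pos d] with ω hω hmem
  change (blueSites lam rho ω).Infinite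
  rw [blueSites_eq hlam hrho hω]
  refine Set.Infinite.mono (Set.subset_insert _ _) (Set.Infinite.image
    (Option.some_injective _).injOn fun hfin => ?_)
  obtain ⟨N, hN⟩ := (hfin.image List.length).bddAbove
  obtain ⟨v, hv, hg⟩ := Set.mem_iInter.1 hmem (N + 1)
  have : v.length ≤ N := hN ⟨v, hg, rfl⟩
  omega

/-! ### Super- and subsolutions -/

theorem transfer_mono {lam : ℝ} (hlam : 0 < lam) {f g : ℝ → ℝ≥0∞} (h : ∀ x, 0 < x → f x ≤ g x)
    (x : ℝ) : transfer lam f x ≤ transfer lam g x := by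
  have hpos : ∀ᵐ z ∂(expMeasure 1).prod (expMeasure 1), 0 < z.2 :=
    Measure.quasiMeasurePreserving_snd.ae expMeasure_one_ae_pos
  refine lintegral_mono_ae ?_
  filter_upwards [hpos] with z hz
  split_ifs with hs
  · apply h
    have : z.1 / lam < x := by rwa [div_lt_iff₀ hlam, mul_comm]
    linarith
  · exact le_rfl

theorem transfer_congr {lam : ℝ} (hlam : 0 < lam) {f g : ℝ → ℝ≥0∞} (h : ∀ x, 0 < x → f x = g x)
    (x : ℝ) : transfer lam f x = transfer lam g x :=
  le_antisymm (transfer_mono hlam (fun y hy => (h y hy).le) x)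
    (transfer_mono hlam (fun y hy => (h y hy).ge) x)

theorem transfer_const_mul {lam : ℝ} (c : ℝ≥0∞) {f : ℝ → ℝ≥0∞} (hf : Measurable f) (x : ℝ) :
    transfer lam (fun y => c * f y) x = c * transfer lam f x := by
  have h : Measurable fun z : ℝ × ℝ =>
      if z.1 < lam * x then f (x - z.1 / lam + z.2) else 0 :=
    Measurable.ite (measurableSet_lt (by fun_prop) (by fun_prop)) (hf.comp (by fun_prop))
      measurable_const
  rw [transfer, transfer, ← lintegral_const_mul _ h]
  refine lintegral_congr fun z => ?_
  split_ifs <;> simp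

theorem transfer_add {lam : ℝ} {f g : ℝ → ℝ≥0∞} (hf : Measurable f) (x : ℝ) :
    transfer lam (fun y => f y + g y) x = transfer lam f x + transfer lam g x := by
  have h : Measurable fun z : ℝ × ℝ =>
      if z.1 < lam * x then f (x - z.1 / lam + z.2) else 0 :=
    Measurable.ite (measurableSet_lt (by fun_prop) (by fun_prop)) (hf.comp (by fun_prop))
      measurable_const
  rw [transfer, transfer, transfer, ← lintegral_add_left h]
  refine lintegral_congr fun z => ?_
  split_ifs <;> simp

theorem transfer_zero (lam x : ℝ) : transfer lam (fun _ => 0) x = 0 := by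
  simp [transfer]

theorem outlive_le_one (rho x : ℝ) : outlive rho x ≤ 1 := prob_le_one

/-- `transfer lam 1 x` is the probability that a given child of a vertex with gap `x` turns red. -/
theorem transfer_one_le (lam x : ℝ) : transfer lam (fun _ => 1) x ≤ 1 := by
  refine (lintegral_mono (g := fun _ => 1) fun z => ?_).trans (by simp)
  split_ifs <;> simp

theorem transfer_le_const {lam : ℝ} (hlam : 0 < lam) {f : ℝ → ℝ≥0∞} {c : ℝ≥0∞}
    (h : ∀ x, 0 < x → f x ≤ c) (x : ℝ) : transfer lam f x ≤ c := by
  refine (transfer_mono hlam (g := fun _ => c * 1) (by simpa using h) x).trans ?_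
  rw [transfer_const_mul c measurable_const]
  exact mul_le_of_le_one_right' (transfer_one_le lam x)

/-- A supersolution bounds the expected number of blue descendants. -/
theorem expectedBlue_lt_top {d : ℕ} {lam rho : ℝ} (hlam : 0 < lam) (hrho : 0 ≤ rho)
    {h : ℝ → ℝ≥0∞} (hint : ∫⁻ x, h x ∂expMeasure 1 ≠ ⊤)
    (hsup : ∀ x, 0 < x → 1 + d * transfer lam (fun y => outlive rho y * h y) x ≤ h x) :
    expectedBlue d lam rho < ⊤ := by
  have hbound (n : ℕ) : ∀ x, 0 < x →
      ∑ k ∈ Finset.range n, (d : ℝ≥0∞) ^ k * pathProb lam rho k x ≤ outlive rho x * h x := by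
    induction n with
    | zero => simp
    | succ n ih =>
      intro x hx
      have hsum : ∀ m, transfer lam
          (fun y => ∑ k ∈ Finset.range m, (d : ℝ≥0∞) ^ k * pathProb lam rho k y) x =
          ∑ k ∈ Finset.range m, (d : ℝ≥0∞) ^ k * transfer lam (pathProb lam rho k) x := by
        intro m
        induction m with
        | zero => simp [transfer_zero]
        | succ m ihm =>
          simp only [Finset.sum_range_succ]
          rw [transfer_add (Finset.measurable_sum _ fun k _ =>
            (measurable_pathProb lam rho k).const_mul _), ihm,
            transfer_const_mul _ (measurable_pathProb lam rho m)]
      rw [Finset.sum_range_succ']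
      calc ∑ k ∈ Finset.range n, (d : ℝ≥0∞) ^ (k + 1) * pathProb lam rho (k + 1) x +
            (d : ℝ≥0∞) ^ 0 * pathProb lam rho 0 x
          = outlive rho x * (1 + d * transfer lam (fun y => ∑ k ∈ Finset.range n,
              (d : ℝ≥0∞) ^ k * pathProb lam rho k y) x) := by
            rw [hsum, mul_add, Finset.mul_sum, Finset.mul_sum, add_comm]
            simp only [pathProb, pow_zero, one_mul, mul_one]
            congr 1
            refine Finset.sum_congr rfl fun k _ => ?_
            ring
        _ ≤ outlive rho x * (1 + d * transfer lam (fun y => outlive rho y * h y) x) := by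
            gcongr
            exact transfer_mono hlam ih x
        _ ≤ outlive rho x * h x := by
            gcongr
            exact hsup x hx
  rw [expectedBlue_eq hlam hrho]
  refine ENNReal.add_lt_top.2 ⟨ENNReal.one_lt_top, lt_of_le_of_lt ?_ (lt_top_iff_ne_top.2 hint)⟩
  simp only [← lintegral_const_mul _ (measurable_pathProb lam rho _)]
  refine ENNReal.tsum_le_of_sum_range_le fun n => ?_
  rw [← lintegral_finsetSum _ fun k _ => (measurable_pathProb lam rho k).const_mul _]
  refine lintegral_mono_ae ?_
  filter_upwards [expMeasure_one_ae_pos] with x hx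
  exact (hbound n x hx).trans (mul_le_of_le_one_left' (outlive_le_one rho x))

/-- A nontrivial bounded subsolution forces the expected number of blue sites to diverge. -/
theorem expectedBlue_eq_top {d : ℕ} {lam rho : ℝ} (hlam : 0 < lam) (hrho : 0 ≤ rho)
    {φ : ℝ → ℝ≥0∞} (hφ1 : ∀ x, 0 < x → φ x ≤ 1)
    (hφ : ∫⁻ x, outlive rho x * φ x ∂expMeasure 1 ≠ 0)
    (hsub : ∀ x, 0 < x → φ x ≤ d * transfer lam (fun y => outlive rho y * φ y) x) :
    expectedBlue d lam rho = ⊤ := by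
  have hbound (n : ℕ) : ∀ x, 0 < x →
      outlive rho x * φ x ≤ (d : ℝ≥0∞) ^ n * pathProb lam rho n x := by
    induction n with
    | zero =>
      intro x hx
      simpa [pathProb] using mul_le_of_le_one_right' (hφ1 x hx)
    | succ n ih =>
      intro x hx
      calc outlive rho x * φ x
          ≤ outlive rho x * (d * transfer lam (fun y => outlive rho y * φ y) x) := by
            gcongr
            exact hsub x hx
        _ ≤ outlive rho x *
              (d * transfer lam (fun y => (d : ℝ≥0∞) ^ n * pathProb lam rho n y) x) := by
            gcongr
            exact transfer_mono hlam ih x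
        _ = (d : ℝ≥0∞) ^ (n + 1) * pathProb lam rho (n + 1) x := by
            rw [transfer_const_mul _ (measurable_pathProb lam rho n), pathProb]
            ring
  rw [expectedBlue_eq hlam hrho, ENNReal.add_eq_top]
  refine Or.inr (top_le_iff.1 ?_)
  rw [← ENNReal.tsum_const_eq_top_of_ne_zero (α := ℕ) hφ]
  refine ENNReal.tsum_le_tsum fun n => ?_
  rw [← lintegral_const_mul _ (measurable_pathProb lam rho n)]
  refine lintegral_mono_ae ?_
  filter_upwards [expMeasure_one_ae_pos] with x hx using hbound n x hx

/-! ### The transfer operator through differential equations -/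

theorem setLIntegral_Ioo_deriv_eq {U u : ℝ → ℝ} {a b : ℝ} (hab : a ≤ b)
    (hU : ∀ s, HasDerivAt U (u s) s) (hu : Continuous u) (hpos : ∀ s ∈ Set.Ioc a b, 0 ≤ u s) :
    ∫⁻ s in Set.Ioo a b, ENNReal.ofReal (u s) = ENNReal.ofReal (U b - U a) := by
  rw [← intervalIntegral.integral_eq_sub_of_hasDerivAt (fun s _ => hU s)
    (hu.intervalIntegrable _ _), intervalIntegral.integral_of_le hab,
    ofReal_integral_eq_lintegral_ofReal
      ((intervalIntegrable_iff_integrableOn_Ioc_of_le hab).1 (hu.intervalIntegrable _ _))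
      ((ae_restrict_iff' measurableSet_Ioc).2 (Filter.Eventually.of_forall hpos))]
  exact setLIntegral_congr Ioo_ae_eq_Ioc

theorem ofReal_sub_le_setLIntegral_Ioo {U u : ℝ → ℝ} {a b : ℝ} (hab : a ≤ b)
    (hU : ∀ s, HasDerivAt U (u s) s) (hu : Continuous u) :
    ENNReal.ofReal (U b - U a) ≤ ∫⁻ s in Set.Ioo a b, ENNReal.ofReal (u s) := by
  have hc : Continuous fun s => max (u s) 0 := hu.max continuous_const
  have hi : IntegrableOn (fun s => max (u s) 0) (Set.Ioc a b) :=
    (intervalIntegrable_iff_integrableOn_Ioc_of_le hab).1 (hc.intervalIntegrable _ _)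
  calc ENNReal.ofReal (U b - U a)
      = ENNReal.ofReal (∫ s in Set.Ioc a b, u s) := by
        rw [← intervalIntegral.integral_eq_sub_of_hasDerivAt (fun s _ => hU s)
          (hu.intervalIntegrable _ _), intervalIntegral.integral_of_le hab]
    _ ≤ ENNReal.ofReal (∫ s in Set.Ioc a b, max (u s) 0) :=
        ENNReal.ofReal_le_ofReal (integral_mono
          ((intervalIntegrable_iff_integrableOn_Ioc_of_le hab).1 (hu.intervalIntegrable _ _)) hi
          fun s => le_max_left _ _)
    _ = ∫⁻ s in Set.Ioo a b, ENNReal.ofReal (u s) := by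
        rw [ofReal_integral_eq_lintegral_ofReal hi
          (Filter.Eventually.of_forall fun s => le_max_right _ _),
          setLIntegral_congr Ioo_ae_eq_Ioc.symm]
        simp [ENNReal.ofReal_max]

/-- The expectation of `f` at `y` plus a standard exponential variable. -/
noncomputable def expShift (f : ℝ → ℝ≥0∞) (y : ℝ) : ℝ≥0∞ := ∫⁻ c, f (y + c) ∂expMeasure 1

theorem transfer_eq_setLIntegral {lam : ℝ} {f : ℝ → ℝ≥0∞} (hf : Measurable f) (x : ℝ) :
    transfer lam f x = ∫⁻ s in Set.Ioo 0 (lam * x),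
      ENNReal.ofReal (Real.exp (-s)) * expShift f (x - s / lam) := by
  have h : Measurable fun z : ℝ × ℝ =>
      if z.1 < lam * x then f (x - z.1 / lam + z.2) else 0 :=
    Measurable.ite (measurableSet_lt (by fun_prop) (by fun_prop)) (hf.comp (by fun_prop))
      measurable_const
  rw [transfer, lintegral_prod _ h.aemeasurable, lintegral_expMeasure_one h.lintegral_prod_right',
    ← Set.Ioi_inter_Iio, Set.inter_comm, ← Measure.restrict_restrict measurableSet_Iio,
    ← lintegral_indicator measurableSet_Iio]
  · refine lintegral_congr fun s => ?_
    by_cases hs : s < lam * x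
    · simp [hs, expShift]
    · simp [hs]

/-- If `g' = g - f` and `g` grows slower than the exponential, then `g` is the expectation of `f`
at a point shifted by a standard exponential variable. -/
theorem expShift_eq {F : ℝ → ℝ≥0∞} (hF : Measurable F) {f g : ℝ → ℝ} {y : ℝ}
    (hf : ∀ z, y ≤ z → 0 ≤ f z ∧ F z = ENNReal.ofReal (f z))
    (hg : ∀ z, HasDerivAt g (g z - f z) z)
    (hlim : Filter.Tendsto (fun z => Real.exp (-z) * g z) Filter.atTop (nhds 0)) :
    0 ≤ g y ∧ expShift F y = ENNReal.ofReal (g y) := by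
  have hder (c : ℝ) : HasDerivAt (fun c => -(Real.exp (-c) * g (y + c)))
      (Real.exp (-c) * f (y + c)) c := by
    have h1 : HasDerivAt (fun c : ℝ => Real.exp (-c)) (-Real.exp (-c)) c := by
      simpa using (hasDerivAt_neg c).exp
    have h2 : HasDerivAt (fun c => g (y + c)) (g (y + c) - f (y + c)) c :=
      HasDerivAt.comp_const_add y c (hg _)
    exact (h1.mul h2).neg.congr_deriv (by ring)
  have hnn (c : ℝ) (hc : c ∈ Set.Ioi (0 : ℝ)) : 0 ≤ Real.exp (-c) * f (y + c) :=
    mul_nonneg (Real.exp_pos _).le (hf _ (by linarith [Set.mem_Ioi.1 hc])).1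
  have hl : Filter.Tendsto (fun c => -(Real.exp (-c) * g (y + c))) Filter.atTop (nhds 0) := by
    have h1 := ((hlim.comp (Filter.tendsto_atTop_add_const_left _ y Filter.tendsto_id)).const_mul
      (Real.exp y)).neg
    simp only [mul_zero, neg_zero] at h1
    refine h1.congr fun c => ?_
    simp only [Function.comp, id, ← mul_assoc, ← Real.exp_add]
    ring_nf
  have hint := integral_Ioi_of_hasDerivAt_of_nonneg' (fun c _ => hder c) hnn hl
  have hio := integrableOn_Ioi_deriv_of_nonneg' (fun c _ => hder c) hnn hl
  simp only [neg_zero, Real.exp_zero, add_zero, one_mul, sub_neg_eq_add, zero_add] at hint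
  refine ⟨hint ▸ setIntegral_nonneg measurableSet_Ioi hnn, ?_⟩
  rw [expShift, lintegral_expMeasure_one (show Measurable fun c => F (y + c) by fun_prop), ← hint,
    ofReal_integral_eq_lintegral_ofReal hio
      ((ae_restrict_iff' measurableSet_Ioi).2 (Filter.Eventually.of_forall hnn))]
  refine setLIntegral_congr_fun measurableSet_Ioi fun c hc => ?_
  rw [(hf (y + c) (by linarith [Set.mem_Ioi.1 hc])).2, ENNReal.ofReal_mul (Real.exp_pos _).le]

/-- A lower bound from values of `f` up to a point where `g` is not positive. -/
theorem le_expShift {F : ℝ → ℝ≥0∞} (hF : Measurable F) {f g : ℝ → ℝ} {y b : ℝ} (hyb : y ≤ b)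
    (hf : ∀ z, y ≤ z → z ≤ b → ENNReal.ofReal (f z) ≤ F z) (hfc : Continuous f)
    (hg : ∀ z, HasDerivAt g (g z - f z) z) (hb : g b ≤ 0) :
    ENNReal.ofReal (g y) ≤ expShift F y := by
  have hder (c : ℝ) : HasDerivAt (fun c => -(Real.exp (-c) * g (y + c)))
      (Real.exp (-c) * f (y + c)) c := by
    have h1 : HasDerivAt (fun c : ℝ => Real.exp (-c)) (-Real.exp (-c)) c := by
      simpa using (hasDerivAt_neg c).exp
    have h2 : HasDerivAt (fun c => g (y + c)) (g (y + c) - f (y + c)) c :=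
      HasDerivAt.comp_const_add y c (hg _)
    exact (h1.mul h2).neg.congr_deriv (by ring)
  have h := ofReal_sub_le_setLIntegral_Ioo (sub_nonneg.2 hyb) hder (by fun_prop)
  simp only [neg_zero, Real.exp_zero, add_zero, one_mul, sub_neg_eq_add] at h
  rw [expShift, lintegral_expMeasure_one (show Measurable fun c => F (y + c) by fun_prop)]
  calc ENNReal.ofReal (g y)
      ≤ ENNReal.ofReal (-(Real.exp (-(b - y)) * g (y + (b - y))) + g y) := by
        refine ENNReal.ofReal_le_ofReal ?_
        rw [add_sub_cancel]
        linarith [mul_nonpos_of_nonneg_of_nonpos (Real.exp_pos (-(b - y))).le hb]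
    _ ≤ ∫⁻ c in Set.Ioo 0 (b - y), ENNReal.ofReal (Real.exp (-c) * f (y + c)) := h
    _ ≤ ∫⁻ c in Set.Ioo 0 (b - y), ENNReal.ofReal (Real.exp (-c)) * F (y + c) := by
        refine setLIntegral_mono' measurableSet_Ioo fun c hc => ?_
        rw [ENNReal.ofReal_mul (Real.exp_pos _).le]
        gcongr
        exact hf _ (by linarith [hc.1]) (by linarith [hc.2])
    _ ≤ ∫⁻ c in Set.Ioi 0, ENNReal.ofReal (Real.exp (-c)) * F (y + c) :=
        lintegral_mono_set Set.Ioo_subset_Ioi_self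

theorem hasDerivAt_exp_neg_mul_comp {lam : ℝ} (hlam : 0 < lam) {g W : ℝ → ℝ}
    (hW : ∀ z, HasDerivAt W (lam * (g z - W z)) z) (x s : ℝ) :
    HasDerivAt (fun s => -(Real.exp (-s) * W (x - s / lam)))
      (Real.exp (-s) * g (x - s / lam)) s := by
  have h1 : HasDerivAt (fun c : ℝ => Real.exp (-c)) (-Real.exp (-s)) s := by
    simpa using (hasDerivAt_neg s).exp
  have h0 : HasDerivAt (fun s : ℝ => x - s / lam) (-(1 / lam)) s :=
    ((hasDerivAt_id s).div_const lam).const_sub x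
  have h2 := (hW (x - s / lam)).comp s h0
  refine (h1.mul h2).neg.congr_deriv ?_
  simp only [Function.comp]
  field_simp
  ring

/-- If `W' = lam * (g - W)`, where `g` is the exponential shift of `f`, then `W` is the image of
`f` under the transfer operator, up to the boundary term at `0`. -/
theorem transfer_eq {lam : ℝ} (hlam : 0 < lam) {F : ℝ → ℝ≥0∞} (hF : Measurable F) {g W : ℝ → ℝ}
    {x : ℝ} (hx : 0 ≤ x)
    (hg : ∀ y, 0 ≤ y → 0 ≤ g y ∧ expShift F y = ENNReal.ofReal (g y)) (hgc : Continuous g)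
    (hW : ∀ z, HasDerivAt W (lam * (g z - W z)) z) :
    transfer lam F x = ENNReal.ofReal (W x - Real.exp (-(lam * x)) * W 0) := by
  have hy (s : ℝ) (hs : s ∈ Set.Ioc 0 (lam * x)) : 0 ≤ x - s / lam := by
    rw [sub_nonneg, div_le_iff₀ hlam, mul_comm]
    exact hs.2
  have h := setLIntegral_Ioo_deriv_eq (mul_nonneg hlam.le hx)
    (hasDerivAt_exp_neg_mul_comp hlam hW x) (by fun_prop)
    fun s hs => mul_nonneg (Real.exp_pos _).le (hg _ (hy s hs)).1
  have h0 : x - lam * x / lam = 0 := by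
    field_simp
    ring
  rw [transfer_eq_setLIntegral hF]
  simp only [neg_zero, Real.exp_zero, zero_div, sub_zero, one_mul, sub_neg_eq_add, h0] at h
  rw [show W x - Real.exp (-(lam * x)) * W 0 = -(Real.exp (-(lam * x)) * W 0) + W x by ring, ← h]
  refine setLIntegral_congr_fun measurableSet_Ioo fun s hs => ?_
  rw [(hg _ (hy s ⟨hs.1, hs.2.le⟩)).2, ENNReal.ofReal_mul (Real.exp_pos _).le]

/-- The one-sided version of `transfer_eq`, on an interval starting at a zero of `W`. -/
theorem le_transfer {lam : ℝ} (hlam : 0 < lam) {F : ℝ → ℝ≥0∞} (hF : Measurable F) {g W : ℝ → ℝ}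
    {a x : ℝ} (ha : 0 ≤ a) (hax : a ≤ x)
    (hg : ∀ y, a ≤ y → y ≤ x → ENNReal.ofReal (g y) ≤ expShift F y) (hgc : Continuous g)
    (hW : ∀ z, HasDerivAt W (lam * (g z - W z)) z) (hWa : W a = 0) :
    ENNReal.ofReal (W x) ≤ transfer lam F x := by
  have h := ofReal_sub_le_setLIntegral_Ioo (mul_nonneg hlam.le (sub_nonneg.2 hax))
    (hasDerivAt_exp_neg_mul_comp hlam hW x) (by fun_prop)
  have h0 : x - lam * (x - a) / lam = a := by
    field_simp
    ring
  simp only [neg_zero, Real.exp_zero, zero_div, sub_zero, one_mul, sub_neg_eq_add, h0, hWa,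
    mul_zero, zero_add] at h
  rw [transfer_eq_setLIntegral hF]
  refine h.trans ?_
  calc ∫⁻ s in Set.Ioo 0 (lam * (x - a)), ENNReal.ofReal (Real.exp (-s) * g (x - s / lam))
      ≤ ∫⁻ s in Set.Ioo 0 (lam * (x - a)),
          ENNReal.ofReal (Real.exp (-s)) * expShift F (x - s / lam) := by
        refine setLIntegral_mono' measurableSet_Ioo fun s hs => ?_
        rw [ENNReal.ofReal_mul (Real.exp_pos _).le]
        gcongr
        have h1 : s / lam < x - a := by
          rw [div_lt_iff₀ hlam, mul_comm]
          exact hs.2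
        have h2 : 0 < s / lam := div_pos hs.1 hlam
        exact hg _ (by linarith) (by linarith)
    _ ≤ _ := by
        refine lintegral_mono_set (Set.Ioo_subset_Ioo_right ?_)
        gcongr
        linarith

theorem outlive_eq {rho x : ℝ} (h : 0 ≤ rho * x) :
    outlive rho x = ENNReal.ofReal (Real.exp (-(rho * x))) := by
  rw [outlive, ← lintegral_indicator_one measurableSet_Ioi,
    lintegral_expMeasure_one (measurable_one.indicator measurableSet_Ioi),
    ← integral_exp_neg_Ioi, ofReal_integral_eq_lintegral_ofReal (integrableOn_exp_neg_Ioi _)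
      (Filter.Eventually.of_forall fun _ => (Real.exp_pos _).le),
    ← lintegral_indicator measurableSet_Ioi, ← lintegral_indicator measurableSet_Ioi]
  refine lintegral_congr fun y => ?_
  by_cases hy : rho * x < y
  · simp [hy, h.trans_lt hy]
  · simp [hy]

theorem transfer_one {lam x : ℝ} (hlam : 0 < lam) (hx : 0 ≤ x) :
    transfer lam (fun _ => 1) x = ENNReal.ofReal (1 - Real.exp (-(lam * x))) := by
  rw [transfer_eq hlam measurable_const (g := fun _ => 1) (W := fun _ => 1) hx
    (fun y _ => ⟨zero_le_one, by simp [expShift]⟩) continuous_const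
    fun z => by simpa using hasDerivAt_const z (1 : ℝ), mul_one]

/-! ### Survival below the critical death rate -/

theorem mul_one_sub_le_one_sub_pow {q : ℝ} (h0 : 0 ≤ q) (h1 : q ≤ 1) (d : ℕ) :
    d * q * (1 - d * q) ≤ 1 - (1 - q) ^ d := by
  have hy : 0 ≤ d * q := by positivity
  have h2 : (1 - q) ^ d ≤ Real.exp (-(d * q)) := by
    calc (1 - q) ^ d ≤ Real.exp (-q) ^ d :=
          pow_le_pow_left₀ (by linarith) (Real.one_sub_le_exp_neg q) d
      _ = Real.exp (-(d * q)) := by rw [← Real.exp_nat_mul]; ring_nf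
  have h3 : Real.exp (-(d * q)) ≤ 1 / (1 + d * q) := by
    rw [Real.exp_neg, one_div]
    exact inv_anti₀ (by linarith) (by linarith [Real.add_one_le_exp (d * q)])
  have h4 : 1 / (1 + d * q) ≤ 1 - d * q + (d * q) ^ 2 := by
    rw [div_le_iff₀ (by linarith)]
    nlinarith [pow_nonneg hy 3]
  nlinarith

theorem min_mul_one_sub_exp_le {lam ε x : ℝ} (hlam : 0 < lam) (hε : 0 < ε) (hx : 0 ≤ x) :
    min 1 (ε / lam) * (1 - Real.exp (-(lam * x))) ≤ 1 - Real.exp (-(ε * x)) := by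
  have h1 : Real.exp (-(lam * x)) ≤ 1 := Real.exp_le_one_iff.2 (by nlinarith)
  rcases le_total lam ε with h | h
  · have h2 : Real.exp (-(ε * x)) ≤ Real.exp (-(lam * x)) := Real.exp_le_exp.2 (by nlinarith)
    nlinarith [min_le_left 1 (ε / lam)]
  · have hθ : ε / lam ≤ 1 := (div_le_one hlam).2 h
    have hθ0 : 0 ≤ ε / lam := (div_pos hε hlam).le
    have h3 := convexOn_exp.2 (Set.mem_univ (-(lam * x))) (Set.mem_univ 0) hθ0
      (sub_nonneg.2 hθ) (add_sub_cancel _ _)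
    simp only [smul_eq_mul, mul_zero, add_zero, Real.exp_zero, mul_one] at h3
    rw [show ε / lam * -(lam * x) = -(ε * x) by field_simp] at h3
    rw [min_eq_right hθ]
    linarith

/-- A nontrivial bounded subsolution at death rate `rho` forces coexistence at every smaller rate
`rho'`: the gain `exp ((rho - rho') * x)` pays for the quadratic error of the branching recursion,
which vanishes linearly as the gap `x` tends to zero. -/
theorem coexistenceProb_ne_zero_of_subsolution {d : ℕ} (hd : 1 ≤ d) {lam rho rho' : ℝ}
    (hlam : 0 < lam) (hrho' : 0 ≤ rho') (hlt : rho' < rho) {φ : ℝ → ℝ≥0∞} (hφm : Measurable φ)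
    (hφ1 : ∀ x, 0 < x → φ x ≤ 1) (hφ : ∫⁻ x, outlive rho x * φ x ∂expMeasure 1 ≠ 0)
    (hsub : ∀ x, 0 < x → φ x ≤ d * transfer lam (fun y => outlive rho y * φ y) x) :
    coexistenceProb d lam rho' ≠ 0 := by
  have hd0 : (0 : ℝ) < d := by exact_mod_cast hd
  set ε := rho - rho' with hε_def
  have hε : 0 < ε := sub_pos.2 hlt
  set η := min 1 (ε / lam) / d with hη_def
  have hη : 0 < η := by positivity
  have hη1 : η ≤ 1 := by
    rw [hη_def, div_le_one hd0]
    exact (min_le_left _ _).trans (by exact_mod_cast hd)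
  have hψm : Measurable fun x => outlive rho x * φ x := (measurable_outlive rho).mul hφm
  refine coexistenceProb_ne_zero hlam hrho'
    (f := fun x => ENNReal.ofReal η * (outlive rho x * φ x)) ?_ fun n => ?_
  · rw [lintegral_const_mul _ hψm]
    exact mul_ne_zero (ENNReal.ofReal_pos.2 hη).ne' hφ
  · induction n with
    | zero =>
      intro x hx
      rw [clockLaw_reachEvent_zero, outlive_eq (by nlinarith), outlive_eq (by positivity)]
      calc ENNReal.ofReal η * (ENNReal.ofReal (Real.exp (-(rho * x))) * φ x)
          ≤ 1 * (ENNReal.ofReal (Real.exp (-(rho' * x))) * 1) := by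
            gcongr
            · exact ENNReal.ofReal_le_one.2 hη1
            · exact hφ1 x hx
        _ = _ := by rw [one_mul, mul_one]
    | succ n ih =>
      intro x hx
      rw [clockLaw_reachEvent_succ]
      have ht : transfer lam (fun y => outlive rho y * φ y) x ≤
          ENNReal.ofReal (1 - Real.exp (-(lam * x))) := by
        rw [← transfer_one hlam hx.le]
        refine transfer_mono hlam (fun y hy => ?_) x
        exact mul_le_one' (outlive_le_one rho y) (hφ1 y hy)
      obtain ⟨t, ht0, htx⟩ : ∃ t : ℝ, 0 ≤ t ∧
          transfer lam (fun y => outlive rho y * φ y) x = ENNReal.ofReal t :=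
        ⟨_, ENNReal.toReal_nonneg, (ENNReal.ofReal_toReal (ne_top_of_le_ne_top
          ENNReal.ofReal_ne_top ht)).symm⟩
      have hexp : 0 ≤ 1 - Real.exp (-(lam * x)) := by
        rw [sub_nonneg, Real.exp_le_one_iff]
        nlinarith
      rw [htx, ENNReal.ofReal_le_ofReal_iff hexp] at ht
      have hlow : ENNReal.ofReal (η * t) ≤
          transfer lam (fun y => clockLaw d {ω | (y, ω) ∈ reachEvent d lam rho' n}) x := by
        rw [ENNReal.ofReal_mul hη.le, ← htx, ← transfer_const_mul _ hψm]
        exact transfer_mono hlam ih x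
      have hq1 : η * t ≤ 1 := by nlinarith [Real.exp_pos (-(lam * x))]
      have hsmall : d * (η * t) ≤ 1 - Real.exp (-(ε * x)) := by
        have h1 : d * η = min 1 (ε / lam) := by
          rw [hη_def]
          field_simp
        calc d * (η * t) = min 1 (ε / lam) * t := by rw [← mul_assoc, h1]
          _ ≤ min 1 (ε / lam) * (1 - Real.exp (-(lam * x))) := by gcongr
          _ ≤ _ := min_mul_one_sub_exp_le hlam hε hx.le
      have hreal : Real.exp (-(ε * x)) * (d * (η * t)) ≤ 1 - (1 - η * t) ^ d := by
        refine le_trans ?_ (mul_one_sub_le_one_sub_pow (by positivity) hq1 d)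
        rw [mul_comm]
        gcongr
        linarith
      calc ENNReal.ofReal η * (outlive rho x * φ x)
          ≤ ENNReal.ofReal η * (outlive rho x * (d * ENNReal.ofReal t)) := by
            rw [← htx]
            gcongr
            exact hsub x hx
        _ = ENNReal.ofReal (Real.exp (-(rho' * x)) *
              (Real.exp (-(ε * x)) * (d * (η * t)))) := by
            rw [outlive_eq (by nlinarith), ← mul_assoc (Real.exp _), ← Real.exp_add,
              ENNReal.ofReal_mul (Real.exp_pos _).le, ENNReal.ofReal_mul hd0.le,
              ENNReal.ofReal_mul hη.le, ENNReal.ofReal_natCast,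
              show -(rho' * x) + -(ε * x) = -(rho * x) by rw [hε_def]; ring]
            ring
        _ ≤ ENNReal.ofReal (Real.exp (-(rho' * x)) * (1 - (1 - η * t) ^ d)) := by
            gcongr
        _ = outlive rho' x * (1 - (1 - ENNReal.ofReal (η * t)) ^ d) := by
            rw [outlive_eq (by positivity), ENNReal.ofReal_mul (Real.exp_pos _).le,
              ENNReal.ofReal_sub _ (pow_nonneg (by linarith) d), ENNReal.ofReal_one,
              ENNReal.ofReal_pow (by linarith), ENNReal.ofReal_sub _ (by positivity),
              ENNReal.ofReal_one]
        _ ≤ _ := by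
            gcongr

/-! ### Stability of bounded supersolutions -/

theorem exp_neg_sub_exp_neg_le {rho κ x : ℝ} (hrho : 0 < rho) (hκ0 : 0 ≤ κ) (hκ : κ ≤ 1 / 2)
    (hx : 0 ≤ x) :
    Real.exp (-(rho * (1 - κ) * x)) ≤ Real.exp (-(rho * x)) + 2 * κ := by
  set y := rho * (1 - κ) * x with hy
  have hy0 : 0 ≤ y := by
    have : 0 ≤ 1 - κ := by linarith
    positivity
  have h1 : Real.exp (-(rho * x)) = Real.exp (-y) * Real.exp (-(κ * (rho * x))) := by
    rw [← Real.exp_add, hy]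
    ring_nf
  have h2 : 1 - κ * (rho * x) ≤ Real.exp (-(κ * (rho * x))) := Real.one_sub_le_exp_neg _
  have h3 : Real.exp (-y) * y ≤ 1 := by
    rw [Real.exp_neg, inv_mul_le_iff₀ (Real.exp_pos y), mul_one]
    linarith [Real.add_one_le_exp y]
  have h4 : rho * x ≤ 2 * y := by
    rw [hy]
    nlinarith [mul_nonneg hrho.le hx]
  rw [h1]
  have h5 : Real.exp (-y) * (1 - κ * (rho * x)) ≤
      Real.exp (-y) * Real.exp (-(κ * (rho * x))) := by gcongr
  have h6 : Real.exp (-y) * (κ * (rho * x)) ≤ Real.exp (-y) * (κ * (2 * y)) := by gcongr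
  nlinarith

/-- If a bounded supersolution exists at a positive death rate, the expected number of blue sites
is finite at a slightly smaller rate too. -/
theorem exists_lt_expectedBlue_lt_top {d : ℕ} {lam rho : ℝ} (hlam : 0 < lam) (hrho : 0 < rho)
    {h : ℝ → ℝ≥0∞} (hm : Measurable h) {M : ℝ} (hM : 0 ≤ M)
    (hbdd : ∀ x, 0 < x → h x ≤ ENNReal.ofReal M)
    (hsup : ∀ x, 0 < x → 1 + d * transfer lam (fun y => outlive rho y * h y) x ≤ h x) :
    ∃ rho', 0 ≤ rho' ∧ rho' < rho ∧ expectedBlue d lam rho' < ⊤ := by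
  set κ : ℝ := 1 / (4 * d * M + 2) with hκ_def
  have hκ0 : 0 < κ := by positivity
  have hκ : κ ≤ 1 / 2 := one_div_le_one_div_of_le (by norm_num)
    (by nlinarith [mul_nonneg (Nat.cast_nonneg (α := ℝ) d) hM])
  have hκM : d * (2 * (2 * κ) * M) ≤ 1 := by
    rw [hκ_def]
    field_simp
    linarith
  have hnn : 0 ≤ rho * (1 - κ) := mul_nonneg hrho.le (by linarith)
  refine ⟨rho * (1 - κ), hnn, by nlinarith, ?_⟩
  refine expectedBlue_lt_top hlam hnn (h := fun x => 2 * h x) ?_ fun x hx => ?_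
  · refine ne_top_of_le_ne_top (b := 2 * ENNReal.ofReal M)
      (ENNReal.mul_ne_top ENNReal.ofNat_ne_top ENNReal.ofReal_ne_top) ?_
    refine (lintegral_mono_ae (g := fun _ => 2 * ENNReal.ofReal M) ?_).trans (by simp)
    filter_upwards [expMeasure_one_ae_pos] with x hx
    gcongr
    exact hbdd x hx
  · have hstep : transfer lam (fun y => outlive (rho * (1 - κ)) y * (2 * h y)) x ≤
        2 * transfer lam (fun y => outlive rho y * h y) x + ENNReal.ofReal (2 * (2 * κ) * M) := by
      have hpm : Measurable fun y => outlive rho y * h y := (measurable_outlive rho).mul hm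
      refine (transfer_mono hlam (g := fun y => 2 * (outlive rho y * h y) +
        ENNReal.ofReal (2 * (2 * κ) * M)) (fun y hy => ?_) x).trans ?_
      · rw [outlive_eq (by positivity), outlive_eq (by positivity)]
        calc ENNReal.ofReal (Real.exp (-(rho * (1 - κ) * y))) * (2 * h y)
            ≤ (ENNReal.ofReal (Real.exp (-(rho * y))) + ENNReal.ofReal (2 * κ)) * (2 * h y) := by
              rw [← ENNReal.ofReal_add (Real.exp_pos _).le (by positivity)]
              gcongr
              exact exp_neg_sub_exp_neg_le hrho hκ0.le hκ hy.le
          _ = 2 * (ENNReal.ofReal (Real.exp (-(rho * y))) * h y) +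
                2 * ENNReal.ofReal (2 * κ) * h y := by ring
          _ ≤ _ := by
              gcongr
              rw [ENNReal.ofReal_mul (p := 2 * (2 * κ)) (by positivity),
                ENNReal.ofReal_mul (p := 2) (q := 2 * κ) zero_le_two, ENNReal.ofReal_ofNat]
              gcongr
              exact hbdd y hy
      · rw [transfer_add (hpm.const_mul 2), transfer_const_mul 2 hpm]
        gcongr
        exact transfer_le_const hlam (fun _ _ => le_rfl) x
    calc 1 + d * transfer lam (fun y => outlive (rho * (1 - κ)) y * (2 * h y)) x
        ≤ 1 + d * (2 * transfer lam (fun y => outlive rho y * h y) x +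
            ENNReal.ofReal (2 * (2 * κ) * M)) := by gcongr
      _ = 1 + 2 * (d * transfer lam (fun y => outlive rho y * h y) x) +
            ENNReal.ofReal (d * (2 * (2 * κ) * M)) := by
          rw [ENNReal.ofReal_mul (Nat.cast_nonneg d), ENNReal.ofReal_natCast]
          ring
      _ ≤ 1 + 2 * (d * transfer lam (fun y => outlive rho y * h y) x) + 1 := by
          gcongr
          exact ENNReal.ofReal_le_one.2 hκM
      _ = 2 * (1 + d * transfer lam (fun y => outlive rho y * h y) x) := by ring
      _ ≤ 2 * h x := by
          gcongr
          exact hsup x hx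

/-! ### The decaying solution of the eigenvalue equation -/

theorem tendsto_exp_neg_mul {r : ℝ} (hr : 0 < r) :
    Filter.Tendsto (fun x : ℝ => Real.exp (-(r * x))) Filter.atTop (nhds 0) :=
  Real.tendsto_exp_neg_atTop_nhds_zero.comp (Filter.tendsto_id.const_mul_atTop hr)

theorem hasDerivAt_exp_mul (r x : ℝ) :
    HasDerivAt (fun x => Real.exp (r * x)) (r * Real.exp (r * x)) x :=
  (((hasDerivAt_id x).const_mul r).exp).congr_deriv (by simp; ring)

theorem hasDerivAt_tsum_pow {a : ℕ → ℝ} (ha : ∀ R : ℝ, 0 ≤ R → Summable fun n => |a n| * R ^ n)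
    (t : ℝ) : HasDerivAt (fun t => ∑' n, a n * t ^ n) (∑' n, a n * (n * t ^ (n - 1))) t := by
  have hR : 0 ≤ |t| + 1 := by positivity
  refine hasDerivAt_tsum_of_isPreconnected (u := fun n => |a n| * (2 * (|t| + 1)) ^ n)
    (ha _ (by positivity)) (t := Metric.ball 0 (|t| + 1)) Metric.isOpen_ball
    (convex_ball _ _).isPreconnected (g := fun n t => a n * t ^ n)
    (g' := fun n t => a n * (n * t ^ (n - 1))) (fun n y _ => (hasDerivAt_pow n y).const_mul (a n))
    (fun n y hy => ?_) (y₀ := 0) (by simpa using by positivity) ?_ (by simp)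
  · rw [mem_ball_zero_iff, Real.norm_eq_abs] at hy
    rw [Real.norm_eq_abs, abs_mul, abs_mul, abs_pow, Nat.abs_cast, mul_pow]
    have hn : (n : ℝ) ≤ 2 ^ n := by exact_mod_cast (Nat.lt_two_pow_self (n := n)).le
    have hy' : |y| ^ (n - 1) ≤ (|t| + 1) ^ n :=
      (pow_le_pow_left₀ (abs_nonneg y) hy.le _).trans
        (pow_le_pow_right₀ (by linarith [abs_nonneg t]) (Nat.sub_le n 1))
    gcongr
  · refine summable_of_ne_finset_zero (s := {0}) fun n hn => ?_
    simp at hn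
    simp [hn]

theorem summable_mul_pow {a : ℕ → ℝ} (ha : ∀ R : ℝ, 0 ≤ R → Summable fun n => |a n| * R ^ n)
    (t : ℝ) : Summable fun n => a n * t ^ n := by
  refine Summable.of_norm_bounded (ha |t| (abs_nonneg t)) fun n => ?_
  rw [Real.norm_eq_abs, abs_mul, abs_pow]

theorem summable_nat_mul {a : ℕ → ℝ} (ha : ∀ R : ℝ, 0 ≤ R → Summable fun n => |a n| * R ^ n)
    (c : ℝ) {R : ℝ} (hR : 0 ≤ R) : Summable fun n => |c * n * a n| * R ^ n := by
  refine Summable.of_nonneg_of_le (fun n => by positivity) (fun n => ?_)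
    ((ha (2 * R) (by positivity)).mul_left |c|)
  have hn : (n : ℝ) ≤ 2 ^ n := by exact_mod_cast (Nat.lt_two_pow_self (n := n)).le
  calc |c * n * a n| * R ^ n = |c| * (|a n| * (n * R ^ n)) := by
        rw [abs_mul, abs_mul, Nat.abs_cast]
        ring
    _ ≤ |c| * (|a n| * (2 * R) ^ n) := by
        rw [mul_pow]
        gcongr

/-- The coefficients `(-lam * z / rho) ^ n / (n! * ∏ j ∈ [1, n], (1 + lam + j * rho))` of the entire
function, of Bessel type, that gives the decaying solution of the eigenvalue equation. -/
noncomputable def besselCoeff (lam rho z : ℝ) : ℕ → ℝ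
  | 0 => 1
  | n + 1 => -(lam * z / rho) * besselCoeff lam rho z n / ((n + 1) * (1 + lam + (n + 1) * rho))

theorem abs_besselCoeff_le {lam rho : ℝ} (hlam : 0 < lam) (hrho : 0 < rho) (z : ℝ) (n : ℕ) :
    |besselCoeff lam rho z n| ≤ |lam * z / rho| ^ n / n.factorial := by
  induction n with
  | zero => simp [besselCoeff]
  | succ n ih =>
    have h1 : 0 < (n : ℝ) + 1 := by positivity
    have h2 : 1 ≤ 1 + lam + (n + 1) * rho := by
      have : 0 < ((n : ℝ) + 1) * rho := by positivity
      linarith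
    rw [besselCoeff, abs_div, abs_mul, abs_neg, Nat.factorial_succ, Nat.cast_mul, pow_succ,
      abs_of_pos (show 0 < ((n : ℝ) + 1) * (1 + lam + (n + 1) * rho) by positivity)]
    calc |lam * z / rho| * |besselCoeff lam rho z n| / ((n + 1) * (1 + lam + (n + 1) * rho))
        ≤ |lam * z / rho| * (|lam * z / rho| ^ n / n.factorial) / ((n + 1) * 1) := by
          gcongr
      _ = _ := by
          push_cast
          field_simp

theorem summable_besselCoeff {lam rho : ℝ} (hlam : 0 < lam) (hrho : 0 < rho) (z R : ℝ)
    (hR : 0 ≤ R) : Summable fun n => |besselCoeff lam rho z n| * R ^ n := by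
  refine Summable.of_nonneg_of_le (fun n => by positivity) (fun n => ?_)
    (Real.summable_pow_div_factorial (|lam * z / rho| * R))
  rw [mul_pow, mul_div_right_comm]
  gcongr
  exact abs_besselCoeff_le hlam hrho z n

/-- For `z = 1 / κ`, the equation `T W = κ W` for the transfer operator `T` with killing
amounts to the system for `W` and `g` below, with `W 0 = 0`. Without the boundary condition
there is always a solution that decays at infinity and is positive there. -/
theorem exists_decaying_solution {lam rho : ℝ} (hlam : 0 < lam) (hrho : 0 < rho) (z : ℝ) :
    ∃ W g : ℝ → ℝ, (∀ x, HasDerivAt W (lam * (g x - W x)) x) ∧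
      (∀ x, HasDerivAt g (g x - z * Real.exp (-(rho * x)) * W x) x) ∧
      Filter.Tendsto (fun x => Real.exp (-x) * g x) Filter.atTop (nhds 0) ∧
      (∀ x, 0 ≤ x → W x ≤ 1) ∧ ∀ᶠ x in Filter.atTop, 0 < W x := by
  set c := besselCoeff lam rho z with hc_def
  have hc := summable_besselCoeff hlam hrho z
  set b : ℕ → ℝ := fun n => -(rho / lam) * n * c n with hb_def
  have hb : ∀ R : ℝ, 0 ≤ R → Summable fun n => |b n| * R ^ n := fun R hR =>
    summable_nat_mul hc _ hR
  set A : ℝ → ℝ := fun t => ∑' n, c n * t ^ n with hA_def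
  set B : ℝ → ℝ := fun t => ∑' n, b n * t ^ n with hB_def
  have hA' (t : ℝ) : HasDerivAt A (∑' n, c n * (n * t ^ (n - 1))) t := hasDerivAt_tsum_pow hc t
  have hB' (t : ℝ) : HasDerivAt B (∑' n, b n * (n * t ^ (n - 1))) t := hasDerivAt_tsum_pow hb t
  have hpow (t : ℝ) (n : ℕ) : t * (n * t ^ (n - 1)) = n * t ^ n := by
    cases n with
    | zero => simp
    | succ n => rw [Nat.add_sub_cancel, pow_succ]; ring
  have hodeA (t : ℝ) : t * ∑' n, c n * (n * t ^ (n - 1)) = -(lam / rho) * B t := by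
    rw [hB_def, ← tsum_mul_left, ← tsum_mul_left]
    refine tsum_congr fun n => ?_
    rw [mul_left_comm, hpow, hb_def]
    field_simp
  have hrec (n : ℕ) : (1 + lam + (n + 1) * rho) * b (n + 1) = z * c n := by
    have h1 : (n : ℝ) + 1 ≠ 0 := by positivity
    have h2 : 1 + lam + (n + 1) * rho ≠ 0 := by positivity
    simp only [hb_def, hc_def, besselCoeff]
    push_cast
    field_simp
  have hodeB (t : ℝ) : (1 + lam) * B t + rho * (t * ∑' n, b n * (n * t ^ (n - 1))) =
      z * t * A t := by
    have hs2 : Summable fun n => n * b n * t ^ n :=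
      summable_mul_pow (fun R hR => by simpa using summable_nat_mul hb 1 hR) t
    rw [← tsum_mul_left (a := t), hB_def, hA_def]
    have h1 : ∀ n, t * (b n * (n * t ^ (n - 1))) = n * b n * t ^ n := fun n => by
      rw [mul_left_comm, hpow]
      ring
    simp only [h1]
    rw [← tsum_mul_left, ← tsum_mul_left, ← tsum_mul_left,
      ← ((summable_mul_pow hb t).mul_left _).tsum_add (hs2.mul_left _),
      (((summable_mul_pow hb t).mul_left _).add (hs2.mul_left _)).tsum_eq_zero_add]
    simp only [hb_def, Nat.cast_zero, mul_zero, zero_mul, add_zero, zero_add]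
    refine tsum_congr fun n => ?_
    have := hrec n
    simp only [hb_def] at this
    push_cast at this ⊢
    linear_combination t ^ (n + 1) * this
  have hAc : Continuous A := continuous_iff_continuousAt.2 fun t => (hA' t).continuousAt
  have hBc : Continuous B := continuous_iff_continuousAt.2 fun t => (hB' t).continuousAt
  have hA0 : A 0 = 1 := by
    rw [hA_def]
    simp only
    rw [tsum_eq_single 0 fun n hn => by simp [hn]]
    simp [hc_def, besselCoeff]
  obtain ⟨M, hM⟩ := (isCompact_Icc (a := (0 : ℝ)) (b := 1)).bddAbove_image hAc.continuousOn
  have hM' (t : ℝ) (h0 : 0 ≤ t) (h1 : t ≤ 1) : A t ≤ M := hM ⟨t, ⟨h0, h1⟩, rfl⟩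
  have hM1 : 1 ≤ M := hA0 ▸ hM' 0 le_rfl zero_le_one
  have hM0 : 0 < M := by linarith
  have hexp (r x : ℝ) : HasDerivAt (fun x => Real.exp (-(r * x))) (-r * Real.exp (-(r * x))) x := by
    simpa only [neg_mul] using hasDerivAt_exp_mul (-r) x
  refine ⟨fun x => Real.exp (-(lam * x)) * A (Real.exp (-(rho * x))) / M,
    fun x => Real.exp (-(lam * x)) * B (Real.exp (-(rho * x))) / M, fun x => ?_, fun x => ?_, ?_,
    fun x hx => ?_, ?_⟩
  · refine (((hexp lam x).mul ((hA' _).comp x (hexp rho x))).div_const M).congr_deriv ?_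
    have h : ∀ t, rho * (t * ∑' n, c n * (n * t ^ (n - 1))) = -lam * B t := fun t => by
      rw [hodeA t]
      field_simp
    simp only [Function.comp]
    linear_combination -(Real.exp (-(lam * x)) / M) * h (Real.exp (-(rho * x)))
  · refine (((hexp lam x).mul ((hB' _).comp x (hexp rho x))).div_const M).congr_deriv ?_
    simp only [Function.comp]
    linear_combination -(Real.exp (-(lam * x)) / M) * hodeB (Real.exp (-(rho * x)))
  · have h1 := (tendsto_exp_neg_mul one_pos).mul (((tendsto_exp_neg_mul hlam).mul
      ((hBc.tendsto 0).comp (tendsto_exp_neg_mul hrho))).div_const M)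
    simpa using h1
  · rw [div_le_one hM0]
    have h1 : Real.exp (-(rho * x)) ≤ 1 := Real.exp_le_one_iff.2 (by nlinarith)
    have h2 : Real.exp (-(lam * x)) ≤ 1 := Real.exp_le_one_iff.2 (by nlinarith)
    calc Real.exp (-(lam * x)) * A (Real.exp (-(rho * x)))
        ≤ Real.exp (-(lam * x)) * M := by
          gcongr
          exact hM' _ (Real.exp_pos _).le h1
      _ ≤ M := mul_le_of_le_one_left hM0.le h2
  · have h1 := (hAc.tendsto 0).comp (tendsto_exp_neg_mul hrho)
    rw [hA0] at h1
    filter_upwards [h1.eventually (lt_mem_nhds zero_lt_one)] with x hx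
    exact div_pos (mul_pos (Real.exp_pos _) hx) hM0

/-! ### Bounds for the transfer operator -/

theorem expShift_exp {r : ℝ} (hr : 0 ≤ r) (y : ℝ) :
    expShift (fun z => ENNReal.ofReal (Real.exp (-(r * z)))) y =
      ENNReal.ofReal (Real.exp (-(r * y)) / (1 + r)) := by
  have h0 : 1 + r ≠ 0 := by positivity
  refine (expShift_eq (by fun_prop) (f := fun z => Real.exp (-(r * z)))
    (g := fun z => Real.exp (-(r * z)) / (1 + r)) (fun z _ => ⟨(Real.exp_pos _).le, rfl⟩)
    (fun z => ?_) ?_).2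
  · have h := (hasDerivAt_exp_mul (-r) z).div_const (1 + r)
    simp only [neg_mul] at h
    refine h.congr_deriv ?_
    field_simp
    ring
  · refine ((tendsto_exp_neg_mul (r := 1 + r) (by positivity)).div_const (1 + r)).congr'
      (Filter.Eventually.of_forall fun z => ?_) |>.trans (by simp)
    rw [mul_div_assoc', ← Real.exp_add]
    ring_nf

/-- `transfer lam F x` averages `expShift F` over `(0, x)`, with total weight at most `1`. -/
theorem transfer_le_of_expShift_le {lam : ℝ} (hlam : 0 < lam) {F : ℝ → ℝ≥0∞} (hF : Measurable F)
    {c : ℝ≥0∞} (h : ∀ y, 0 < y → expShift F y ≤ c) (x : ℝ) : transfer lam F x ≤ c := by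
  rw [transfer_eq_setLIntegral hF]
  calc ∫⁻ s in Set.Ioo 0 (lam * x), ENNReal.ofReal (Real.exp (-s)) * expShift F (x - s / lam)
      ≤ ∫⁻ s in Set.Ioo 0 (lam * x), ENNReal.ofReal (Real.exp (-s)) * c := by
        refine setLIntegral_mono' measurableSet_Ioo fun s hs => ?_
        gcongr
        apply h
        rw [sub_pos, div_lt_iff₀ hlam, mul_comm]
        exact hs.2
    _ ≤ ∫⁻ s in Set.Ioi 0, ENNReal.ofReal (Real.exp (-s)) * c :=
        lintegral_mono_set Set.Ioo_subset_Ioi_self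
    _ = c := by
        rw [← lintegral_expMeasure_one (f := fun _ => c) measurable_const]
        simp

/-- A vertex with a large gap is unlikely to have a child that turns red and outlives its own
gap. -/
theorem exists_transfer_outlive_le {lam rho : ℝ} (hlam : 0 < lam) (hrho : 0 < rho) {ε : ℝ}
    (hε : 0 < ε) : ∃ R, 0 ≤ R ∧ ∀ x, R ≤ x → transfer lam (outlive rho) x ≤ ENNReal.ofReal ε := by
  -- The exponent is kept below `lam`, where the explicit solution has a resonance.
  set r := min rho (lam / 2) with hr_def
  have hr : 0 < r := by positivity
  have hrl : 0 < lam - r := by linarith [min_le_right rho (lam / 2)]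
  have hbound (x : ℝ) (hx : 0 ≤ x) : transfer lam (outlive rho) x ≤
      ENNReal.ofReal (lam / ((1 + r) * (lam - r)) * Real.exp (-(r * x))) := by
    calc transfer lam (outlive rho) x
        ≤ transfer lam (fun y => ENNReal.ofReal (Real.exp (-(r * y)))) x := by
          refine transfer_mono hlam (fun y hy => ?_) x
          rw [outlive_eq (by positivity)]
          have : r ≤ rho := min_le_left _ _
          gcongr
      _ = ENNReal.ofReal (lam / ((1 + r) * (lam - r)) * Real.exp (-(r * x)) -
            Real.exp (-(lam * x)) * (lam / ((1 + r) * (lam - r)) * Real.exp (-(r * 0)))) := by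
          refine transfer_eq hlam (by fun_prop) (g := fun y => Real.exp (-(r * y)) / (1 + r))
            (W := fun y => lam / ((1 + r) * (lam - r)) * Real.exp (-(r * y))) hx
            (fun y _ => ⟨by positivity, expShift_exp hr.le y⟩) (by fun_prop) fun y => ?_
          have h := (hasDerivAt_exp_mul (-r) y).const_mul (lam / ((1 + r) * (lam - r)))
          simp only [neg_mul] at h
          refine h.congr_deriv ?_
          field_simp
          ring
      _ ≤ _ := by
          refine ENNReal.ofReal_le_ofReal (sub_le_self _ ?_)
          positivity
  have hlim := (tendsto_exp_neg_mul hr).const_mul (lam / ((1 + r) * (lam - r)))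
  rw [mul_zero] at hlim
  obtain ⟨R, hR⟩ := Filter.eventually_atTop.1 (hlim.eventually (gt_mem_nhds hε))
  refine ⟨max R 0, le_max_right _ _, fun x hx => ?_⟩
  exact (hbound x ((le_max_right _ _).trans hx)).trans
    (ENNReal.ofReal_le_ofReal (hR x ((le_max_left _ _).trans hx)).le)

theorem lintegral_expMeasure_ne_zero {f : ℝ → ℝ≥0∞} (hf : Measurable f) {a b : ℝ} (ha : 0 ≤ a)
    (hab : a < b) (h : ∀ x, a < x → x < b → f x ≠ 0) : ∫⁻ x, f x ∂expMeasure 1 ≠ 0 := by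
  rw [lintegral_expMeasure_one hf]
  intro h0
  rw [lintegral_eq_zero_iff (by fun_prop)] at h0
  have h1 := (ae_restrict_iff' measurableSet_Ioi).1 h0
  have h2 : volume (Set.Ioo a b) = 0 := by
    refine measure_mono_null (fun x hx => ?_) (ae_iff.1 h1)
    intro hc
    have := hc (Set.mem_Ioi.2 (ha.trans_lt hx.1))
    simp only [Pi.zero_apply, mul_eq_zero, ENNReal.ofReal_eq_zero, not_le.2 (Real.exp_pos _),
      false_or] at this
    exact h x hx.1 hx.2 this
  rw [Real.volume_Ioo, ENNReal.ofReal_eq_zero] at h2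
  linarith

/-- If `W' = lam * (g - W)` with `g ≥ 0`, then `exp (lam * x) * W x` is nondecreasing. -/
theorem exp_mul_le_of_hasDerivAt {lam : ℝ} (hlam : 0 < lam) {g W : ℝ → ℝ}
    (hgc : Continuous g) (hg : ∀ y, 0 ≤ y → 0 ≤ g y)
    (hW : ∀ z, HasDerivAt W (lam * (g z - W z)) z) {x : ℝ} (hx : 0 ≤ x) :
    Real.exp (-(lam * x)) * W 0 ≤ W x := by
  have h := intervalIntegral.integral_eq_sub_of_hasDerivAt (a := 0) (b := lam * x)
    (fun s _ => hasDerivAt_exp_neg_mul_comp hlam hW x s)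
    (Continuous.intervalIntegrable (by fun_prop) _ _)
  have hnn : 0 ≤ ∫ s in (0 : ℝ)..(lam * x), Real.exp (-s) * g (x - s / lam) := by
    refine intervalIntegral.integral_nonneg (by positivity) fun s hs => ?_
    refine mul_nonneg (Real.exp_pos _).le (hg _ ?_)
    rw [sub_nonneg, div_le_iff₀ hlam, mul_comm]
    exact hs.2
  have h0 : x - lam * x / lam = 0 := by
    field_simp
    ring
  simp only [neg_zero, Real.exp_zero, zero_div, sub_zero, one_mul, sub_neg_eq_add, h0] at h
  linarith

/-! ### The dichotomy at a positive death rate -/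

section Dichotomy

variable {d : ℕ} {lam rho : ℝ} {W g : ℝ → ℝ}

theorem hasDerivAt_comp_continuous {f f' : ℝ → ℝ} (h : ∀ x, HasDerivAt f (f' x) x) :
    Continuous f :=
  continuous_iff_continuousAt.2 fun x => (h x).continuousAt

/-- If the decaying solution is positive on `[0, ∞)`, a combination with a constant is a bounded
supersolution: the boundary value `W 0` provides the slack for small gaps, and large gaps are
harmless. -/
theorem exists_supersolution (hlam : 0 < lam) (hrho : 0 < rho)
    (hW : ∀ x, HasDerivAt W (lam * (g x - W x)) x)
    (hg : ∀ x, HasDerivAt g (g x - d * Real.exp (-(rho * x)) * W x) x)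
    (hlim : Filter.Tendsto (fun x => Real.exp (-x) * g x) Filter.atTop (nhds 0))
    (hW1 : ∀ x, 0 ≤ x → W x ≤ 1) (hpos : ∀ x, 0 ≤ x → 0 < W x) :
    ∃ (h : ℝ → ℝ≥0∞) (M : ℝ), Measurable h ∧ 0 ≤ M ∧ (∀ x, 0 < x → h x ≤ ENNReal.ofReal M) ∧
      ∀ x, 0 < x → 1 + d * transfer lam (fun y => outlive rho y * h y) x ≤ h x := by
  have hWc : Continuous W := hasDerivAt_comp_continuous hW
  have hgc : Continuous g := hasDerivAt_comp_continuous hg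
  have hshift : ∀ y, 0 ≤ y → 0 ≤ g y ∧ expShift (fun z =>
      ENNReal.ofReal (d * Real.exp (-(rho * z)) * W z)) y = ENNReal.ofReal (g y) := by
    intro y hy
    refine expShift_eq (by fun_prop) (fun z hz => ⟨?_, rfl⟩) hg hlim
    have := hpos z (hy.trans hz)
    positivity
  obtain ⟨R, hR0, hR⟩ := exists_transfer_outlive_le hlam hrho
    (ε := 1 / (2 * d + 1)) (by positivity)
  have hW0 := hpos 0 le_rfl
  set C : ℝ := 2 * d / (W 0 * Real.exp (-(lam * R))) with hC_def
  have hC : 0 ≤ C := by positivity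
  refine ⟨fun x => ENNReal.ofReal C * ENNReal.ofReal (W x) + 2, C + 2, by fun_prop, by positivity,
    fun x hx => ?_, fun x hx => ?_⟩
  · change ENNReal.ofReal C * ENNReal.ofReal (W x) + 2 ≤ _
    rw [← ENNReal.ofReal_mul hC, ENNReal.ofReal_add hC zero_le_two, ENNReal.ofReal_ofNat]
    gcongr
    exact mul_le_of_le_one_right hC (hW1 x hx.le)
  · have hop : d * transfer lam (fun y => outlive rho y *
          (ENNReal.ofReal C * ENNReal.ofReal (W y) + 2)) x =
        ENNReal.ofReal (C * (W x - Real.exp (-(lam * x)) * W 0)) +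
          d * (2 * transfer lam (outlive rho) x) := by
      have hout := measurable_outlive rho
      have hF : Measurable fun z => ENNReal.ofReal (d * Real.exp (-(rho * z)) * W z) := by fun_prop
      rw [ENNReal.ofReal_mul hC, ← transfer_eq hlam hF hx.le hshift hgc hW,
        ← transfer_const_mul _ hF, ← transfer_const_mul 2 hout,
        ← transfer_const_mul _ (hout.const_mul 2), ← transfer_add (hF.const_mul _),
        ← transfer_const_mul _ (by fun_prop)]
      refine transfer_congr hlam (fun y hy => ?_) x
      rw [ENNReal.ofReal_mul (by positivity), ENNReal.ofReal_mul (by positivity),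
        ENNReal.ofReal_natCast, outlive_eq (by positivity)]
      ring
    have hmono := exp_mul_le_of_hasDerivAt hlam hgc (fun y hy => (hshift y hy).1) hW hx.le
    rw [hop]
    rcases le_total R x with hx' | hx'
    · have h1 : d * (2 * transfer lam (outlive rho) x) ≤ 1 := by
        calc d * (2 * transfer lam (outlive rho) x)
            ≤ d * (2 * ENNReal.ofReal (1 / (2 * d + 1))) := by
              gcongr
              exact hR x hx'
          _ = ENNReal.ofReal (d * (2 * (1 / (2 * d + 1)))) := by
              rw [ENNReal.ofReal_mul (by positivity), ENNReal.ofReal_mul zero_le_two,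
                ENNReal.ofReal_natCast, ENNReal.ofReal_ofNat]
          _ ≤ 1 := by
              rw [ENNReal.ofReal_le_one, ← mul_assoc, mul_one_div, div_le_one (by positivity)]
              linarith
      calc 1 + (ENNReal.ofReal (C * (W x - Real.exp (-(lam * x)) * W 0)) +
              d * (2 * transfer lam (outlive rho) x))
          ≤ 1 + (ENNReal.ofReal (C * W x) + 1) := by
            gcongr
            exact sub_le_self _ (by positivity)
        _ = _ := by
            rw [ENNReal.ofReal_mul hC, ← one_add_one_eq_two]
            ring
    · have h1 : d * (2 * transfer lam (outlive rho) x) ≤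
          ENNReal.ofReal (C * (Real.exp (-(lam * x)) * W 0)) := by
        calc d * (2 * transfer lam (outlive rho) x) ≤ d * (2 * 1) := by
              gcongr
              exact transfer_le_const hlam (fun y _ => outlive_le_one rho y) x
          _ = ENNReal.ofReal (2 * d) := by
              rw [ENNReal.ofReal_mul zero_le_two, ENNReal.ofReal_natCast, ENNReal.ofReal_ofNat]
              ring
          _ ≤ _ := by
              refine ENNReal.ofReal_le_ofReal ?_
              calc (2 : ℝ) * d = C * (Real.exp (-(lam * R)) * W 0) := by
                    rw [hC_def]
                    field_simp
                _ ≤ _ := by gcongr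
      calc 1 + (ENNReal.ofReal (C * (W x - Real.exp (-(lam * x)) * W 0)) +
              d * (2 * transfer lam (outlive rho) x))
          ≤ 1 + (ENNReal.ofReal (C * (W x - Real.exp (-(lam * x)) * W 0)) +
              ENNReal.ofReal (C * (Real.exp (-(lam * x)) * W 0))) := by gcongr
        _ = 1 + ENNReal.ofReal C * ENNReal.ofReal (W x) := by
            rw [← ENNReal.ofReal_add (mul_nonneg hC (sub_nonneg.2 hmono)) (by positivity),
              ← mul_add, sub_add_cancel, ENNReal.ofReal_mul hC]
        _ ≤ ENNReal.ofReal C * ENNReal.ofReal (W x) + 2 := by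
            rw [add_comm]
            gcongr
            exact one_le_two

/-- If the decaying solution has a zero on `[0, ∞)`, its restriction to the right of its largest
zero is a subsolution. -/
theorem exists_subsolution (hlam : 0 < lam) (hrho : 0 < rho)
    (hW : ∀ x, HasDerivAt W (lam * (g x - W x)) x)
    (hg : ∀ x, HasDerivAt g (g x - d * Real.exp (-(rho * x)) * W x) x)
    (hlim : Filter.Tendsto (fun x => Real.exp (-x) * g x) Filter.atTop (nhds 0))
    (hW1 : ∀ x, 0 ≤ x → W x ≤ 1) (hev : ∀ᶠ x in Filter.atTop, 0 < W x)
    (hneg : ∃ x, 0 ≤ x ∧ W x ≤ 0) :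
    ∃ φ : ℝ → ℝ≥0∞, Measurable φ ∧ (∀ x, 0 < x → φ x ≤ 1) ∧
      (∫⁻ x, outlive rho x * φ x ∂expMeasure 1 ≠ 0) ∧
      ∀ x, 0 < x → φ x ≤ d * transfer lam (fun y => outlive rho y * φ y) x := by
  have hWc : Continuous W := hasDerivAt_comp_continuous hW
  have hgc : Continuous g := hasDerivAt_comp_continuous hg
  set S : Set ℝ := Set.Ici 0 ∩ W ⁻¹' Set.Iic 0 with hS
  have hSc : IsClosed S := isClosed_Ici.inter (isClosed_Iic.preimage hWc)
  have hSne : S.Nonempty := hneg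
  have hSb : BddAbove S := by
    obtain ⟨X, hX⟩ := Filter.eventually_atTop.1 hev
    refine ⟨X, fun x hx => ?_⟩
    by_contra hlt
    exact absurd (hX x (not_le.1 hlt).le) (not_lt.2 hx.2)
  set a := sSup S with ha_def
  have haS : a ∈ S := hSc.csSup_mem hSne hSb
  have ha0 : 0 ≤ a := haS.1
  have hgt (x : ℝ) (hx : a < x) : 0 < W x := by
    by_contra hle
    exact absurd (le_csSup hSb (show x ∈ S from ⟨ha0.trans hx.le, not_lt.1 hle⟩)) (not_le.2 hx)
  have hWa : W a = 0 := by
    refine le_antisymm haS.2 ?_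
    refine ge_of_tendsto ((hWc.tendsto a).mono_left (nhdsWithin_le_nhds (s := Set.Ioi a))) ?_
    filter_upwards [self_mem_nhdsWithin] with x hx using (hgt x hx).le
  have hge (x : ℝ) (hx : a ≤ x) : 0 ≤ W x := by
    rcases hx.eq_or_lt with rfl | h
    · exact hWa.ge
    · exact (hgt x h).le
  set φ : ℝ → ℝ≥0∞ := fun x => if a ≤ x then ENNReal.ofReal (W x) else 0 with hφ
  have hφm : Measurable φ :=
    Measurable.ite measurableSet_Ici (by fun_prop) measurable_const
  have hFm : Measurable fun y => (d : ℝ≥0∞) * (outlive rho y * φ y) :=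
    ((measurable_outlive rho).mul hφm).const_mul _
  refine ⟨φ, hφm, fun x hx => ?_, ?_, fun x hx => ?_⟩
  · simp only [hφ]
    split_ifs
    · exact ENNReal.ofReal_le_one.2 (hW1 x hx.le)
    · exact zero_le
  · refine lintegral_expMeasure_ne_zero ((measurable_outlive rho).mul hφm) ha0 (lt_add_one a)
      fun x hx _ => ?_
    have hx0 : 0 ≤ x := ha0.trans hx.le
    rw [outlive_eq (by positivity)]
    simp only [hφ, if_pos hx.le]
    exact mul_ne_zero (ENNReal.ofReal_pos.2 (Real.exp_pos _)).ne'
      (ENNReal.ofReal_pos.2 (hgt x hx)).ne'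
  · by_cases hax : a ≤ x
    · have hψm : Measurable fun y => outlive rho y * φ y := (measurable_outlive rho).mul hφm
      rw [← transfer_const_mul _ hψm]
      have hφx : φ x = ENNReal.ofReal (W x) := if_pos hax
      rw [hφx]
      refine le_transfer hlam hFm ha0 hax (fun y hy _ => ?_) hgc hW hWa
      refine (expShift_eq hFm (fun z hz => ⟨?_, ?_⟩) hg hlim).2.ge
      · have := hge z (hy.trans hz)
        positivity
      · have hz0 : 0 ≤ z := ha0.trans (hy.trans hz)
        have hφz : φ z = ENNReal.ofReal (W z) := if_pos (hy.trans hz)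
        rw [outlive_eq (by positivity), hφz, ENNReal.ofReal_mul (by positivity),
          ENNReal.ofReal_mul (by positivity), ENNReal.ofReal_natCast, mul_assoc]
    · have hφx : φ x = 0 := if_neg hax
      rw [hφx]
      exact zero_le

theorem exists_supersolution_or_subsolution (d : ℕ) (hlam : 0 < lam) (hrho : 0 < rho) :
    (∃ (h : ℝ → ℝ≥0∞) (M : ℝ), Measurable h ∧ 0 ≤ M ∧ (∀ x, 0 < x → h x ≤ ENNReal.ofReal M) ∧
      ∀ x, 0 < x → 1 + d * transfer lam (fun y => outlive rho y * h y) x ≤ h x) ∨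
    (∃ φ : ℝ → ℝ≥0∞, Measurable φ ∧ (∀ x, 0 < x → φ x ≤ 1) ∧
      (∫⁻ x, outlive rho x * φ x ∂expMeasure 1 ≠ 0) ∧
      ∀ x, 0 < x → φ x ≤ d * transfer lam (fun y => outlive rho y * φ y) x) := by
  obtain ⟨W, g, hW, hg, hlim, hW1, hev⟩ := exists_decaying_solution hlam hrho (d : ℝ)
  by_cases hpos : ∀ x, 0 ≤ x → 0 < W x
  · exact Or.inl (exists_supersolution hlam hrho hW hg hlim hW1 hpos)
  · push Not at hpos
    exact Or.inr (exists_subsolution hlam hrho hW hg hlim hW1 hev hpos)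

end Dichotomy

/-! ### Ordinary chase-escape and large death rates -/

/-- For a large death rate the constant `2` is a supersolution. -/
theorem expectedBlue_two_mul_lt_top (d : ℕ) {lam : ℝ} (hlam : 0 < lam) :
    expectedBlue d lam (2 * d) < ⊤ := by
  have hd : (0 : ℝ) ≤ 2 * d := by positivity
  refine expectedBlue_lt_top hlam hd (h := fun _ => 2) (by simp) fun x hx => ?_
  have h1 : transfer lam (fun y => outlive (2 * d) y * 2) x ≤
      2 * ENNReal.ofReal (1 / (1 + 2 * d)) := by
    have hm : Measurable fun y : ℝ => ENNReal.ofReal (Real.exp (-(2 * d * y))) := by fun_prop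
    calc transfer lam (fun y => outlive (2 * d) y * 2) x
        = 2 * transfer lam (fun y => ENNReal.ofReal (Real.exp (-(2 * d * y)))) x := by
          rw [← transfer_const_mul 2 hm]
          refine transfer_congr hlam (fun y hy => ?_) x
          rw [outlive_eq (by positivity), mul_comm]
      _ ≤ 2 * ENNReal.ofReal (1 / (1 + 2 * d)) := by
          gcongr
          refine transfer_le_of_expShift_le hlam hm (fun y hy => ?_) x
          rw [expShift_exp hd]
          gcongr
          exact Real.exp_le_one_iff.2 (by nlinarith)
  calc 1 + d * transfer lam (fun y => outlive (2 * d) y * 2) x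
      ≤ 1 + d * (2 * ENNReal.ofReal (1 / (1 + 2 * d))) := by gcongr
    _ = 1 + ENNReal.ofReal (d * (2 * (1 / (1 + 2 * d)))) := by
        rw [ENNReal.ofReal_mul (Nat.cast_nonneg d), ENNReal.ofReal_mul zero_le_two,
          ENNReal.ofReal_natCast, ENNReal.ofReal_ofNat]
    _ ≤ 1 + 1 := by
        gcongr
        rw [ENNReal.ofReal_le_one, ← mul_assoc, mul_one_div, div_le_one (by positivity)]
        linarith
    _ = 2 := one_add_one_eq_two

/-- Without deaths, `4 * d * lam > (1 + lam) ^ 2` makes the characteristic roots complex, and one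
positive arch of an oscillating solution is a subsolution. -/
theorem expectedBlue_zero_eq_top {d : ℕ} {lam : ℝ} (hlam : 0 < lam)
    (hcrit : (1 + lam) ^ 2 < 4 * d * lam) : expectedBlue d lam 0 = ⊤ := by
  set α : ℝ := (1 - lam) / 2 with hα
  set ω : ℝ := √(d * lam - ((1 + lam) / 2) ^ 2) with hω_def
  have hω : 0 < ω := Real.sqrt_pos.2 (by nlinarith)
  have hω2 : ω ^ 2 = d * lam - ((1 + lam) / 2) ^ 2 := Real.sq_sqrt (by nlinarith)
  set b : ℝ := Real.pi / ω with hb_def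
  have hb : 0 < b := div_pos Real.pi_pos hω
  have hωb : ω * b = Real.pi := by
    rw [hb_def]
    field_simp
  set M : ℝ := Real.exp (|α| * b) with hM_def
  have hM : 0 < M := Real.exp_pos _
  set W : ℝ → ℝ := fun x => Real.exp (α * x) * Real.sin (ω * x) / M with hW_def
  set g : ℝ → ℝ := fun x =>
    Real.exp (α * x) * ((α + lam) * Real.sin (ω * x) + ω * Real.cos (ω * x)) / (lam * M) with hg_def
  have hsin (x : ℝ) : HasDerivAt (fun x => Real.sin (ω * x)) (ω * Real.cos (ω * x)) x :=
    (((hasDerivAt_id x).const_mul ω).sin).congr_deriv (by simp; ring)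
  have hcos (x : ℝ) : HasDerivAt (fun x => Real.cos (ω * x)) (-(ω * Real.sin (ω * x))) x :=
    (((hasDerivAt_id x).const_mul ω).cos).congr_deriv (by simp; ring)
  have hW (x : ℝ) : HasDerivAt W (lam * (g x - W x)) x := by
    refine (((hasDerivAt_exp_mul α x).mul (hsin x)).div_const M).congr_deriv ?_
    simp only [hW_def, hg_def]
    field_simp
    ring
  have hg (x : ℝ) : HasDerivAt g (g x - d * W x) x := by
    refine (((hasDerivAt_exp_mul α x).mul (((hsin x).const_mul (α + lam)).add
      ((hcos x).const_mul ω))).div_const (lam * M)).congr_deriv ?_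
    have hroot : α * (α + lam) - ω ^ 2 = (α + lam) - d * lam := by
      rw [hω2, hα]
      ring
    have hsum : α + (α + lam) = 1 := by
      rw [hα]
      ring
    simp only [hW_def, hg_def, Pi.add_apply]
    rw [← mul_div_mul_left (Real.exp (α * x) * Real.sin (ω * x)) M hlam.ne']
    linear_combination Real.exp (α * x) / (lam * M) *
      (Real.sin (ω * x) * hroot + ω * Real.cos (ω * x) * hsum)
  have hWc : Continuous W := hasDerivAt_comp_continuous hW
  have hgc : Continuous g := hasDerivAt_comp_continuous hg
  have hW0 : W 0 = 0 := by simp [hW_def]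
  have hgb : g b ≤ 0 := by
    simp only [hg_def, hωb, Real.sin_pi, Real.cos_pi]
    refine div_nonpos_of_nonpos_of_nonneg ?_ (by positivity)
    nlinarith [Real.exp_pos (α * b)]
  have hpos (x : ℝ) (h0 : 0 < x) (h1 : x < b) : 0 < W x := by
    refine div_pos (mul_pos (Real.exp_pos _) (Real.sin_pos_of_pos_of_lt_pi (by positivity) ?_)) hM
    rw [← hωb]
    gcongr
  have hle (x : ℝ) (h0 : 0 ≤ x) (h1 : x ≤ b) : W x ≤ 1 := by
    rw [hW_def]
    simp only
    rw [div_le_one hM]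
    have h2 : α * x ≤ |α| * b :=
      mul_le_mul (le_abs_self α) h1 h0 (abs_nonneg α)
    calc Real.exp (α * x) * Real.sin (ω * x) ≤ Real.exp (α * x) * 1 := by
          gcongr
          exact Real.sin_le_one _
      _ ≤ M := by
          rw [mul_one]
          exact Real.exp_le_exp.2 h2
  set φ : ℝ → ℝ≥0∞ := fun x => if x ≤ b then ENNReal.ofReal (W x) else 0 with hφ
  have hφm : Measurable φ := Measurable.ite measurableSet_Iic (by fun_prop) measurable_const
  have hψm : Measurable fun y => outlive 0 y * φ y := (measurable_outlive 0).mul hφm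
  have hout (y : ℝ) : outlive 0 y = 1 := by
    rw [outlive_eq (by simp)]
    simp
  refine expectedBlue_eq_top hlam le_rfl (φ := φ) (fun x hx => ?_) ?_ fun x hx => ?_
  · simp only [hφ]
    split_ifs with h
    · exact ENNReal.ofReal_le_one.2 (hle x hx.le h)
    · exact zero_le
  · refine lintegral_expMeasure_ne_zero hψm le_rfl hb fun x h0 h1 => ?_
    simp only [hout, one_mul, hφ, if_pos h1.le]
    exact (ENNReal.ofReal_pos.2 (hpos x h0 h1)).ne'
  · by_cases hxb : x ≤ b
    · have hφx : φ x = ENNReal.ofReal (W x) := if_pos hxb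
      rw [hφx, ← transfer_const_mul _ hψm]
      refine le_transfer hlam (hψm.const_mul _) le_rfl hx.le (fun y _ hyx => ?_) hgc hW hW0
      refine le_expShift (hψm.const_mul _) (hyx.trans hxb) (fun z _ hzb => ?_)
        (hWc.const_mul (d : ℝ)) hg hgb
      have hφz : φ z = ENNReal.ofReal (W z) := if_pos hzb
      rw [hout, one_mul, hφz, ENNReal.ofReal_mul (Nat.cast_nonneg d), ENNReal.ofReal_natCast]
    · have hφx : φ x = 0 := if_neg hxb
      rw [hφx]
      exact zero_le

/-- Without deaths, `4 * d * lam = (1 + lam) ^ 2` gives a double characteristic root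
`α = (1 - lam) / 2 < 1`, and `(d * exp (α * x) - 1) / (d - 1)` solves the equation for the expected
number of blue descendants. -/
theorem expectedBlue_zero_lt_top {d : ℕ} (hd : 2 ≤ d) {lam : ℝ} (hlam : 0 < lam) (hlam1 : lam < 1)
    (hcrit : 4 * d * lam = (1 + lam) ^ 2) : expectedBlue d lam 0 < ⊤ := by
  have hd2 : (2 : ℝ) ≤ d := by exact_mod_cast hd
  have hd1 : 0 < (d : ℝ) - 1 := by linarith
  set α : ℝ := (1 - lam) / 2 with hα
  have hα0 : 0 < α := by rw [hα]; linarith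
  have hα1 : 0 < 1 - α := by rw [hα]; linarith
  have hroot : lam * d = (α + lam) * (1 - α) := by
    rw [hα]
    linarith
  set f : ℝ → ℝ := fun x => (d * Real.exp (α * x) - 1) / (d - 1) with hf_def
  set g : ℝ → ℝ := fun x => d * (d * Real.exp (α * x) / (1 - α) - 1) / (d - 1) with hg_def
  have hf1 (x : ℝ) (hx : 0 ≤ x) : 1 ≤ f x := by
    rw [hf_def]
    simp only
    rw [le_div_iff₀ hd1]
    have : 1 ≤ Real.exp (α * x) := Real.one_le_exp (by positivity)
    nlinarith
  have hg (x : ℝ) : HasDerivAt g (g x - d * f x) x := by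
    refine ((((((hasDerivAt_exp_mul α x).const_mul (d : ℝ)).div_const (1 - α)).sub_const 1
      ).const_mul (d : ℝ)).div_const ((d : ℝ) - 1)).congr_deriv ?_
    simp only [hg_def, hf_def]
    field_simp
    ring
  have hW (x : ℝ) : HasDerivAt (fun x => f x - 1) (lam * (g x - (f x - 1))) x := by
    refine (((((hasDerivAt_exp_mul α x).const_mul (d : ℝ)).sub_const 1).div_const
      ((d : ℝ) - 1)).sub_const 1).congr_deriv ?_
    simp only [hg_def, hf_def]
    field_simp
    linear_combination -d * Real.exp (α * x) * hroot
  have hlim : Filter.Tendsto (fun x => Real.exp (-x) * g x) Filter.atTop (nhds 0) := by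
    have h1 := ((((tendsto_exp_neg_mul hα1).const_mul (d : ℝ)).div_const (1 - α)).sub
      (tendsto_exp_neg_mul one_pos)).const_mul (d / ((d : ℝ) - 1))
    simp only [mul_zero, zero_div, sub_zero] at h1
    refine h1.congr fun x => ?_
    have h2 : Real.exp (-((1 - α) * x)) = Real.exp (-x) * Real.exp (α * x) := by
      rw [← Real.exp_add]
      ring_nf
    rw [h2, one_mul, hg_def]
    field_simp
  have hfc : Continuous f := by fun_prop
  have hFm : Measurable fun y => ENNReal.ofReal (d * f y) := by fun_prop
  have hshift (y : ℝ) (hy : 0 ≤ y) : 0 ≤ g y ∧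
      expShift (fun y => ENNReal.ofReal (d * f y)) y = ENNReal.ofReal (g y) := by
    refine expShift_eq hFm (fun z hz => ⟨?_, rfl⟩) hg hlim
    have := hf1 z (hy.trans hz)
    positivity
  have hout (y : ℝ) : outlive 0 y = 1 := by
    rw [outlive_eq (by simp)]
    simp
  refine expectedBlue_lt_top hlam le_rfl (h := fun x => ENNReal.ofReal (f x)) ?_ fun x hx => ?_
  · have h0 := (hshift 0 le_rfl).2
    refine ne_top_of_le_ne_top (b := expShift (fun y => ENNReal.ofReal (d * f y)) 0) ?_ ?_
    · rw [h0]
      exact ENNReal.ofReal_ne_top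
    · refine lintegral_mono_ae ?_
      filter_upwards [expMeasure_one_ae_pos] with x hx
      rw [zero_add]
      refine ENNReal.ofReal_le_ofReal ?_
      nlinarith [hf1 x hx.le]
  · have h1 : d * transfer lam (fun y => outlive 0 y * ENNReal.ofReal (f y)) x =
        ENNReal.ofReal (f x - 1) := by
      simp only [hout, one_mul]
      rw [← transfer_const_mul _ (by fun_prop)]
      have hW0 : f 0 - 1 = 0 := by
        simp only [hf_def, mul_zero, Real.exp_zero, mul_one]
        rw [div_self hd1.ne', sub_self]
      have h2 := transfer_eq hlam hFm hx.le hshift (hasDerivAt_comp_continuous hg) hW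
      rw [hW0, mul_zero, sub_zero] at h2
      rw [← h2]
      simp only [ENNReal.ofReal_mul (Nat.cast_nonneg d), ENNReal.ofReal_natCast]
    rw [h1, ← ENNReal.ofReal_one, ← ENNReal.ofReal_add zero_le_one (by linarith [hf1 x hx.le])]
    exact ENNReal.ofReal_le_ofReal (by linarith)

/-! ### The critical rates -/

theorem lamMinus_pos {d : ℕ} (hd : 2 ≤ d) : 0 < lamMinus d := by
  have hd2 : (2 : ℝ) ≤ d := by exact_mod_cast hd
  have h : √((d : ℝ) ^ 2 - d) < d - 1 / 2 := by
    rw [Real.sqrt_lt' (by linarith)]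
    nlinarith
  rw [lamMinus]
  linarith

theorem lamMinus_lt_one {d : ℕ} (hd : 2 ≤ d) : lamMinus d < 1 := by
  have hd2 : (2 : ℝ) ≤ d := by exact_mod_cast hd
  have h : (d : ℝ) - 1 < √((d : ℝ) ^ 2 - d) := by
    rw [Real.lt_sqrt (by linarith)]
    nlinarith
  rw [lamMinus]
  linarith

theorem sq_sqrt_sq_sub {d : ℕ} (hd : 2 ≤ d) : √((d : ℝ) ^ 2 - d) ^ 2 = (d : ℝ) ^ 2 - d := by
  have hd2 : (2 : ℝ) ≤ d := by exact_mod_cast hd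
  exact Real.sq_sqrt (by nlinarith)

theorem four_mul_lamMinus {d : ℕ} (hd : 2 ≤ d) :
    4 * d * lamMinus d = (1 + lamMinus d) ^ 2 := by
  have h := sq_sqrt_sq_sub hd
  rw [lamMinus]
  linear_combination -4 * h

theorem sq_lt_of_mem_Lam {d : ℕ} (hd : 2 ≤ d) {lam : ℝ} (h : lam ∈ Lam d) :
    (1 + lam) ^ 2 < 4 * d * lam := by
  have h1 : lamMinus d < lam := h.1
  have h2 : lam < lamPlus d := h.2
  have h3 := sq_sqrt_sq_sub hd
  rw [lamMinus] at h1
  rw [lamPlus] at h2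
  nlinarith [mul_pos (sub_pos.2 h1) (sub_pos.2 h2)]

theorem exists_coexistenceProb_eq_zero {d : ℕ} {lam rho : ℝ} (hlam : 0 < lam)
    (h : rhoC d lam < rho) : ∃ rho', 0 ≤ rho' ∧ rho' < rho ∧ coexistenceProb d lam rho' = 0 := by
  have hne : {rho : ℝ | 0 ≤ rho ∧ coexistenceProb d lam rho = 0}.Nonempty :=
    ⟨2 * d, by positivity,
      coexistenceProb_eq_zero hlam (by positivity) (expectedBlue_two_mul_lt_top d hlam)⟩
  obtain ⟨rho', h1, h2⟩ := exists_lt_of_csInf_lt hne h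
  exact ⟨rho', h1.1, h2, h1.2⟩

theorem rhoC_nonneg (d : ℕ) (lam : ℝ) : 0 ≤ rhoC d lam :=
  Real.sInf_nonneg fun _ h => h.1

theorem rhoC_le {d : ℕ} {lam rho : ℝ} (h0 : 0 ≤ rho) (h : coexistenceProb d lam rho = 0) :
    rhoC d lam ≤ rho :=
  csInf_le ⟨0, fun _ h => h.1⟩ ⟨h0, h⟩

theorem expectedBlue_lt_top_of_rhoC_lt {d : ℕ} (hd : 1 ≤ d) {lam rho : ℝ} (hlam : 0 < lam)
    (h : rhoC d lam < rho) : expectedBlue d lam rho < ⊤ := by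
  have hrho : 0 < rho := (rhoC_nonneg d lam).trans_lt h
  rcases exists_supersolution_or_subsolution d hlam hrho with
    ⟨f, M, -, -, hbdd, hsup⟩ | ⟨φ, hφm, hφ1, hφ, hsub⟩
  · refine expectedBlue_lt_top hlam hrho.le (ne_top_of_le_ne_top
      (b := ∫⁻ _, ENNReal.ofReal M ∂expMeasure 1) (by simp) (lintegral_mono_ae ?_)) hsup
    filter_upwards [expMeasure_one_ae_pos] with x hx using hbdd x hx
  · obtain ⟨rho', h0, hlt, hco⟩ := exists_coexistenceProb_eq_zero hlam h
    exact absurd hco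
      (coexistenceProb_ne_zero_of_subsolution hd hlam h0 hlt hφm hφ1 hφ hsub)

theorem expectedBlue_rhoC {d : ℕ} {lam : ℝ} (hlam : 0 < lam)
    (hcrit : (1 + lam) ^ 2 < 4 * d * lam) : expectedBlue d lam (rhoC d lam) = ⊤ := by
  rcases (rhoC_nonneg d lam).eq_or_lt with h0 | hrho
  · rw [← h0]
    exact expectedBlue_zero_eq_top hlam hcrit
  · rcases exists_supersolution_or_subsolution d hlam hrho with
      ⟨f, M, hm, hM, hbdd, hsup⟩ | ⟨φ, -, hφ1, hφ, hsub⟩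
    · obtain ⟨rho', h0, hlt, hfin⟩ := exists_lt_expectedBlue_lt_top hlam hrho hm hM hbdd hsup
      exact absurd (rhoC_le h0 (coexistenceProb_eq_zero hlam h0 hfin)) (not_le.2 hlt)
    · exact expectedBlue_eq_top hlam hrho.le hφ1 hφ hsub

end ChaseEscape

theorem theorem2 (d : ℕ) (hd : 2 ≤ d) :
    (∀ lam ∈ ChaseEscape.Lam d,
      (∀ rho : ℝ, ChaseEscape.rhoC d lam < rho → ChaseEscape.expectedBlue d lam rho < ⊤) ∧
      (∀ rho : ℝ, rho = ChaseEscape.rhoC d lam → ChaseEscape.expectedBlue d lam rho = ⊤)) ∧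
    ChaseEscape.expectedBlue d (ChaseEscape.lamMinus d) 0 < ⊤ := by
  refine ⟨fun lam hmem => ?_, ChaseEscape.expectedBlue_zero_lt_top hd
    (ChaseEscape.lamMinus_pos hd) (ChaseEscape.lamMinus_lt_one hd)
    (ChaseEscape.four_mul_lamMinus hd)⟩
  have hlam : 0 < lam := (ChaseEscape.lamMinus_pos hd).trans hmem.1
  refine ⟨fun rho h => ChaseEscape.expectedBlue_lt_top_of_rhoC_lt (by omega) hlam h, ?_⟩
  rintro rho rfl
  exact ChaseEscape.expectedBlue_rhoC hlam (ChaseEscape.sq_lt_of_mem_Lam hd hmem)
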